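/- **Setting.** Let $\Sigma$ be a compact translation surface: a compact Hausdorff surface with a discrete (hence finite) set $\mathfrak B$ of singularities, an atlas of charts to $\mathbb R^2=\mathbb C$ on $\Sigma\smallsetminus\mathfrak B$ whose transition maps are locally translations, and cone angle $2\pi m$, with an integer $m\ge 1$, at each singularity ($m=1$ being allowed, as a marked ordinary point). The vertical flow moves points of $\Sigma\smallsetminus\mathfrak B$ upward at unit speed; points that fall into a singularity disappear. A point of $\Sigma\smallsetminus\mathfrak B$ is *forward-critical* (*backward-critical*) if the forward (backward) vertical flow drops it into a singularity in finite time. Let $\mathfrak W^-$ and $\mathfrak W^+$ be the sets of forward- and backward-critical points, and let $\mathfrak W=\mathfrak W^+\cup\mathfrak W^-$ be the union of the critical leaves. $\Sigma$ *has no saddle connections* if $\mathfrak W^+\cap\mathfrak W^-=\varnothing$. A *generalized saddle connection* is a straight segment $\gamma$ (in any direction) for the flat metric whose two endpoints are singularities (possibly the same one) and whose interior contains no singularity. Let $Q_\gamma=\int_\gamma\omega\in\mathbb C$ be its holonomy, where $\omega=dz$ in translation charts $z$. For $\varphi:[0,\infty)\to(0,\infty)$, $\Sigma$ is *$\varphi$-Diophantine*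 if only finitely many generalized saddle connections $\gamma$ satisfy $|\operatorname{Re}Q_\gamma|<\varphi(|Q_\gamma|)$. A *well-cut segment* $Z$ is an open horizontal segment of positive length in $\Sigma\smallsetminus\mathfrak B$ whose two endpoints lie on critical leaves (the endpoints may coincide), such that the forward vertical flow drops each forward-critical endpoint into a singularity without carrying it through $Z$, and the backward vertical flow drops each backward-critical endpoint into a singularity without carrying it through $Z$. Let $\alpha$ be the first return relation on $Z$ of the vertical flow, so that $\alpha^{-1}$ is that of the backward flow, and let $W=Z\cap\mathfrak W$. Let $B^-$ be the set of points of $Z\cap\mathfrak W^-$ that the forward flow drops into a singularity without returning them to $Z$ (the break points of $\alpha$), and let $B^+$ be the set of points of $Z\cap\mathfrak W^+$ that the backward flow drops into a singularity without returning them to $Z$ (the break points of $\alpha^{-1}$). The *grade* $\operatorname{gr}(w)$ of $w\in W$ is the least $n\in\mathbb N$ such that $\alpha^n w\in B^-$ or $\alpha^{-n}w\in B^+$. Fix $K>1$. For $r>0$ let $W_{\ge r}=\{w\in W: K^{-\operatorname{gr}(w)}\ge r\}$, and let $\operatorname{gap}(r)\in(0,\infty]$ be the minimum Euclidean distance, measured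 along $Z$, between distinct points of $W_{\ge r}$ (with $\operatorname{gap}(r)=\infty$ if there are no two such points). The segment $Z$ satisfies the *fat gap condition* if for every $\lambda>0$ there is a $c>0$ such that $K^{\lambda n}\operatorname{gap}(K^{-n})\ge c$ for all $n\in\mathbb N$. The surface $\Sigma$ satisfies the fat gap condition if all its well-cut segments do. **Proposition.** Let $K>1$. Suppose $\Sigma$ has no saddle connections, and the vertical flow on $\Sigma\smallsetminus(\mathfrak B\cup\mathfrak W)$ is uniquely ergodic (it has exactly one invariant Borel probability measure). If $\Sigma$ is $(K^{-\lambda t})$-Diophantine for every $\lambda>0$, then $\Sigma$ satisfies the fat gap condition. -/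

import Mathlib

open Set Filter Topology MeasureTheory

/-- A translation structure, possibly with conical singularities, on a surface `X`. Away from the
closed discrete set `sing` there is an atlas of charts to `ℂ = ℝ²` whose transition maps are
(locally) translations; each singularity has cone angle `2πm` for some `m ≥ 1`
(`m = 1` is a marked ordinary point). -/
structure TranslationSurface (X : Type*) [TopologicalSpace X] where
  /-- the set of singularities -/
  sing : Set X
  /-- the translation charts -/
  charts : Set (OpenPartialHomeomorph X ℂ)
  charts_regular : ∀ z ∈ charts, z.source ⊆ singᶜ
  charts_cover : ∀ p, p ∉ sing → ∃ z ∈ charts, p ∈ z.source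
  transition : ∀ z ∈ charts, ∀ w ∈ charts, ∀ p ∈ z.source ∩ w.source,
    ∀ᶠ q in 𝓝 p, w q - w p = z q - z p
  /-- Near a singularity there is a coordinate `ζ`, centred there, for which `ζ ^ m` is a local
  translation coordinate away from the centre: the flat metric is a cone of angle `2πm`. -/
  cone : ∀ b ∈ sing, ∃ m : ℕ, 1 ≤ m ∧ ∃ ζ : OpenPartialHomeomorph X ℂ,
    b ∈ ζ.source ∧ ζ b = 0 ∧ ζ.source ∩ sing = {b} ∧
    ∀ z ∈ charts, ∀ p ∈ z.source ∩ ζ.source,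
      ∀ᶠ q in 𝓝 p, z q - z p = ζ q ^ m - ζ p ^ m

namespace TranslationSurface

variable {X : Type*} [TopologicalSpace X] (S : TranslationSurface X)

/-- On the parameter set `J`, the curve `c` avoids the singularities and, in every translation
chart, is a straight line with constant velocity `v`. (This makes `c` continuous on `J`.) -/
def IsStraight (v : ℂ) (c : ℝ → X) (J : Set ℝ) : Prop :=
  ∀ s ∈ J, c s ∉ S.sing ∧ ∀ z ∈ S.charts, c s ∈ z.source →
    ∀ᶠ r in 𝓝[J] s, c r ∈ z.source ∧ z (c r) - z (c s) = ((r - s : ℝ) : ℂ) * v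

/-- The straight-line flow with velocity `v` carries `p` to `q` at time `t` (which may be
negative). This is a relation: nothing is reached after falling into a singularity.
The vertical flow has `v = Complex.I`, the backward vertical flow `v = -Complex.I`. -/
def Flow (v : ℂ) (t : ℝ) (p q : X) : Prop :=
  ∃ c : ℝ → X, c 0 = p ∧ c t = q ∧ S.IsStraight v c (uIcc 0 t)

/-- The points which the flow with velocity `v` drops into a singularity at a positive time. -/
def critical (v : ℂ) : Set X :=
  {p | ∃ T : ℝ, 0 < T ∧ ∃ b ∈ S.sing, ∃ c : ℝ → X, c 0 = p ∧ S.IsStraight v c (Ico 0 T) ∧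
    Tendsto c (𝓝[<] T) (𝓝 b)}

/-- The union of the forward-critical vertical leaves (those that dive into a singularity). -/
def forwardCritical : Set X := S.critical Complex.I

/-- The union of the backward-critical vertical leaves (those that shoot out of a singularity). -/
def backwardCritical : Set X := S.critical (-Complex.I)

/-- The union of all critical vertical leaves. -/
def criticalLeaves : Set X := S.forwardCritical ∪ S.backwardCritical

/-- No vertical leaf is critical in both directions. -/
def NoSaddleConnections : Prop := Disjoint S.forwardCritical S.backwardCritical

/-- The points of the surface which are neither singular nor on a critical leaf. -/
def noncritical : Set X := (S.sing ∪ S.criticalLeaves)ᶜ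

/-- The vertical flow on the complement of the critical leaves has exactly one invariant Borel
probability measure. -/
def VerticalFlowUniquelyErgodic [MeasurableSpace X] : Prop :=
  ∃! μ : Measure S.noncritical, IsProbabilityMeasure μ ∧
    ∀ (t : ℝ) (A : Set S.noncritical), MeasurableSet A →
      μ {p | ∃ q ∈ A, S.Flow Complex.I t p q} = μ A

/-- `γ` is a generalized saddle connection with holonomy `Q`: a geodesic of the flat metric, not
necessarily vertical, from a singularity to a singularity (possibly the same) with no singularity
in between, parametrized with constant velocity `Q` on `[0, 1]`, so that `∫_γ ω = Q`. -/
def IsGeneralizedSaddleConnection (γ : C(unitInterval, X)) (Q : ℂ) : Prop :=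
  Q ≠ 0 ∧ γ 0 ∈ S.sing ∧ γ 1 ∈ S.sing ∧
    S.IsStraight Q (IccExtend zero_le_one γ) (Ioo 0 1)

/-- Only finitely many generalized saddle connections `γ` satisfy `|Re Q_γ| < φ(|Q_γ|)`. -/
def IsDiophantine (φ : ℝ → ℝ) : Prop :=
  {γ : C(unitInterval, X) | ∃ Q : ℂ, S.IsGeneralizedSaddleConnection γ Q ∧
    |Q.re| < φ ‖Q‖}.Finite

/-- The flow with velocity `v` does not carry `p` to a point of `Z` at any positive time. -/
def NeverMeets (v : ℂ) (p : X) (Z : Set X) : Prop :=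
  ∀ t : ℝ, 0 < t → ∀ q, S.Flow v t p q → q ∉ Z

/-- The open segment `h '' Ioo 0 ℓ`, with `h` its arclength parametrization from left to right, is
a well-cut horizontal segment. (The endpoints may coincide.) -/
structure IsWellCut (ℓ : ℝ) (h : ℝ → X) : Prop where
  pos : 0 < ℓ
  horizontal : S.IsStraight 1 h (Icc 0 ℓ)
  injOn : InjOn h (Ioo 0 ℓ)
  left_mem : h 0 ∈ S.criticalLeaves
  right_mem : h ℓ ∈ S.criticalLeaves
  forward : ∀ e ∈ ({0, ℓ} : Set ℝ), h e ∈ S.forwardCritical →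
    S.NeverMeets Complex.I (h e) (h '' Ioo 0 ℓ)
  backward : ∀ e ∈ ({0, ℓ} : Set ℝ), h e ∈ S.backwardCritical →
    S.NeverMeets (-Complex.I) (h e) (h '' Ioo 0 ℓ)

section Segment

/-! Points of the segment `h '' Ioo 0 ℓ` are denoted by their parameters in `Ioo 0 ℓ`; the
Euclidean distance on the segment is the distance of parameters. -/

variable (ℓ : ℝ) (h : ℝ → X)

/-- The first return relation on the segment under the flow with velocity `v`: for
`v = Complex.I` it is `α`, for `v = -Complex.I` it is `α⁻¹`. -/
def FirstReturn (v : ℂ) (s s' : ℝ) : Prop :=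
  s ∈ Ioo 0 ℓ ∧ s' ∈ Ioo 0 ℓ ∧ ∃ t : ℝ, 0 < t ∧ S.Flow v t (h s) (h s') ∧
    ∀ r ∈ Ioo 0 t, ∀ q, S.Flow v r (h s) q → q ∉ h '' Ioo 0 ℓ

/-- The `n`-th iterate of the first return relation. -/
def IterReturn (v : ℂ) : ℕ → ℝ → ℝ → Prop
  | 0 => fun s s' => s = s'
  | n + 1 => fun s s' => ∃ u, S.FirstReturn ℓ h v s u ∧ IterReturn v n u s'

/-- `W`: the positions in the segment of the critical leaves. -/
def positions : Set ℝ := {s ∈ Ioo 0 ℓ | h s ∈ S.criticalLeaves}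

/-- The places where the leaves that fall into a singularity with velocity `v` last pass through
the segment before falling in. For `v = Complex.I` these are the break points of `α`,
for `v = -Complex.I` those of `α⁻¹`. -/
def breaks (v : ℂ) : Set ℝ :=
  {s ∈ Ioo 0 ℓ | h s ∈ S.critical v ∧ S.NeverMeets v (h s) (h '' Ioo 0 ℓ)}

/-- The grade of a position of a critical leaf: how many iterations of `α` or `α⁻¹` bring it to a
break point of the same relation. Break points have grade zero. -/
noncomputable def grade (s : ℝ) : ℕ :=
  sInf {n | (∃ b ∈ S.breaks ℓ h Complex.I, S.IterReturn ℓ h Complex.I n s b) ∨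
    (∃ b ∈ S.breaks ℓ h (-Complex.I), S.IterReturn ℓ h (-Complex.I) n s b)}

/-- The height `K ^ (-grade)`. -/
noncomputable def height (K : ℝ) (s : ℝ) : ℝ := K ^ (-(S.grade ℓ h s : ℝ))

/-- The least distance between distinct points of `W` of height at least `r`
(`⊤` if there are no two such points). -/
noncomputable def gap (K r : ℝ) : ENNReal :=
  {s ∈ S.positions ℓ h | r ≤ S.height ℓ h K s}.einfsep

/-- The fat gap condition for the segment: for all `ε > 0`, the quantity
`K ^ (ε n) * gap (K ^ (-n))` is bounded below by a positive number as `n` varies. -/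
def SegmentFatGap (K : ℝ) : Prop :=
  ∀ ε : ℝ, 0 < ε → ∃ c : ℝ, 0 < c ∧ ∀ n : ℕ,
    ENNReal.ofReal c ≤ ENNReal.ofReal (K ^ (ε * n)) * S.gap ℓ h K (K ^ (-(n : ℝ)))

end Segment

/-- The fat gap condition for the surface: all its well-cut segments satisfy it. -/
def FatGap (K : ℝ) : Prop :=
  ∀ (ℓ : ℝ) (h : ℝ → X), S.IsWellCut ℓ h → S.SegmentFatGap ℓ h K

end TranslationSurface

/-! Two points of `W` of grade at most `n` which are close together produce a generalized saddle
connection which is almost vertical and not too long; the Diophantine condition then limits how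
close they can be.

First return times to a well-cut segment are bounded (`IsWellCut.exists_bound_return`), so a point
of grade at most `n` falls into a singularity, upward or downward, within time `T = C (n + 1)`
(`IsWellCut.exists_bound_falls`). Only finitely many points of the segment fall within time `T`
(`finite_falls`), so from two such points one can pass to two neighbouring ones, no farther apart.
No trajectory starting strictly between these meets a singularity within time `T` in either
direction, hence the flow maps an open rectangle of height `2 T` to the surface by a local isometry
(`locDev_strip`), with a singularity on each vertical side. The image of the straight line joining
the two is a generalized saddle connection (`exists_saddle_of_strip`, `exists_saddle`) with `0 < Re
Q` at most the original distance and `|Im Q| ≤ 2 T`. With exponent `ε / (2 C)` the Diophantine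
condition gives `Re Q ≥ const * K ^ (-ε n)`, apart from finitely many curves whose positive values
of `Re Q` have a positive lower bound (`IsWellCut.segmentFatGap`).

For the bound on return times, consider an interval without break points. Some point of it returns,
since otherwise the forward trajectories would fill a half-infinite strip, which does not fit in a
compact surface (`exists_return`). Returning by a fixed time is an open condition, and so is not
doing so: a return can be lost only through an endpoint of the segment, and well-cutness prevents
this (`IsWellCut.eventually_not_returnsBy`). Hence the whole interval returns by a common time.
Break points are finite in number because falling trajectories pass through finitely many gates
(`exists_gates`, `finite_breaks`). -/

namespace TranslationSurface

/-! ### Straight curves in coordinates -/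

section

variable {X : Type*} [TopologicalSpace X] {S : TranslationSurface X}

/-- The form in which all continuation arguments along intervals are made: a property whose truth
value is locally constant spreads from one parameter to all. -/
theorem forall_of_locally_constant {α : Type*} [TopologicalSpace α] {J : Set α}
    (hJ : IsPreconnected J) {G : α → Prop}
    (hG : ∀ x ∈ J, ∀ᶠ y in 𝓝[J] x, (G x ↔ G y)) {x y : α} (hx : x ∈ J) (hy : y ∈ J)
    (hGx : G x) : G y := by
  have := hJ.induction₂ (fun x y => (G x ↔ G y)) hG (fun _ _ _ _ _ _ h h' => h.trans h')
    (fun _ _ _ _ h => h.symm) hx hy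
  exact this.1 hGx

variable (S) in
/-- Along the filter `l`, the map `f` is close to the regular point `p`, and its displacement from
`p` in translation charts is `g`. -/
def LocDev {α : Type*} (l : Filter α) (f : α → X) (g : α → ℂ) (p : X) : Prop :=
  p ∉ S.sing ∧ ∀ z ∈ S.charts, p ∈ z.source →
    ∀ᶠ r in l, f r ∈ z.source ∧ z (f r) - z p = g r

variable (S) in
/-- `ζ` is a coordinate centred at `p` whose `m`-th power is a local translation coordinate;
`m = 1` unless `p` is singular. -/
structure IsCoord (p : X) (m : ℕ) (ζ : OpenPartialHomeomorph X ℂ) : Prop where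
  one_le : 1 ≤ m
  mem : p ∈ ζ.source
  map_self : ζ p = 0
  eq_of_sing : ∀ q ∈ ζ.source, q ∈ S.sing → q = p
  pow_local : ∀ z ∈ S.charts, ∀ q ∈ z.source ∩ ζ.source,
      ∀ᶠ q' in 𝓝 q, z q' - z q = ζ q' ^ m - ζ q ^ m
  eq_one : p ∉ S.sing → m = 1

variable (S) in
-- A regular point gets a translation chart recentred at the point, with `m = 1`. Regular and
-- singular points can then be treated by the same arguments.
theorem exists_isCoord (p : X) : ∃ m ζ, S.IsCoord p m ζ := by
  by_cases hp : p ∈ S.sing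
  · obtain ⟨m, hm, ζ, h1, h2, h3, h4⟩ := S.cone p hp
    refine ⟨m, ζ, hm, h1, h2, fun q hq hqs => ?_, h4, fun h => absurd hp h⟩
    have : q ∈ ζ.source ∩ S.sing := ⟨hq, hqs⟩
    rw [h3] at this
    exact this
  · obtain ⟨z, hz, hpz⟩ := S.charts_cover p hp
    refine ⟨1, z.transHomeomorph (Homeomorph.addRight (-(z p))), le_rfl, hpz, by simp,
      fun q hq hqs => absurd hqs (S.charts_regular z hz hq), fun w hw q hq => ?_, fun _ => rfl⟩
    filter_upwards [S.transition z hz w hw q ⟨hq.2, hq.1⟩] with q' hq'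
    simpa using hq'

theorem LocDev.tendsto {α : Type*} {l : Filter α} {f : α → X} {g : α → ℂ} {p : X}
    (h : S.LocDev l f g p) (hg : Tendsto g l (𝓝 0)) : Tendsto f l (𝓝 p) := by
  obtain ⟨z, hz, hpz⟩ := S.charts_cover p h.1
  have h1 := h.2 z hz hpz
  have h2 : Tendsto (fun r => z p + g r) l (𝓝 (z p)) := by
    simpa using hg.const_add (z p)
  have h3 := (z.continuousAt_symm (z.map_source hpz)).tendsto.comp h2
  rw [z.left_inv hpz] at h3
  refine h3.congr' ?_
  filter_upwards [h1] with r hr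
  simp only [Function.comp]
  rw [← hr.2, add_sub_cancel, z.left_inv hr.1]

theorem LocDev.coord {α : Type*} {l : Filter α} {f : α → X} {g : α → ℂ} {p x : X} {m : ℕ}
    {ζ : OpenPartialHomeomorph X ℂ} (h : S.LocDev l f g p) (hg : Tendsto g l (𝓝 0))
    (hζ : S.IsCoord x m ζ) (hp : p ∈ ζ.source) :
    ∀ᶠ r in l, f r ∈ ζ.source ∧ ζ (f r) ^ m - ζ p ^ m = g r := by
  obtain ⟨z, hz, hpz⟩ := S.charts_cover p h.1
  have ht := h.tendsto hg
  filter_upwards [h.2 z hz hpz, ht.eventually (ζ.open_source.mem_nhds hp),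
    ht.eventually (hζ.pow_local z hz p ⟨hpz, hp⟩)] with r h1 h2 h3
  exact ⟨h2, by rw [← h3, h1.2]⟩

/-- A coordinate with `m = 1` differs from every translation chart by a local translation, so a
displacement needs to be computed in one coordinate only. -/
theorem LocDev.of_coord {α : Type*} {l : Filter α} {f : α → X} {g : α → ℂ} {p x : X}
    {ζ : OpenPartialHomeomorph X ℂ} (hζ : S.IsCoord x 1 ζ) (hp : p ∈ ζ.source)
    (hps : p ∉ S.sing) (hg : Tendsto g l (𝓝 0))
    (h : ∀ᶠ r in l, f r ∈ ζ.source ∧ ζ (f r) - ζ p = g r) : S.LocDev l f g p := by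
  have ht : Tendsto f l (𝓝 p) := by
    have h2 : Tendsto (fun r => ζ p + g r) l (𝓝 (ζ p)) := by
      simpa using hg.const_add (ζ p)
    have h3 := (ζ.continuousAt_symm (ζ.map_source hp)).tendsto.comp h2
    rw [ζ.left_inv hp] at h3
    refine h3.congr' ?_
    filter_upwards [h] with r hr
    simp only [Function.comp]
    rw [← hr.2, add_sub_cancel, ζ.left_inv hr.1]
  refine ⟨hps, fun z hz hpz => ?_⟩
  filter_upwards [h, ht.eventually (z.open_source.mem_nhds hpz),
    ht.eventually (hζ.pow_local z hz p ⟨hpz, hp⟩)] with r h1 h2 h3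
  exact ⟨h2, by rw [h3, pow_one, pow_one, h1.2]⟩

/-- Charts are injective, so displacements determine points; this is the source of uniqueness for
trajectories. -/
theorem LocDev.eventuallyEq {α : Type*} {l : Filter α} {f f' : α → X} {g : α → ℂ} {p : X}
    (h : S.LocDev l f g p) (h' : S.LocDev l f' g p) : f =ᶠ[l] f' := by
  obtain ⟨z, hz, hpz⟩ := S.charts_cover p h.1
  filter_upwards [h.2 z hz hpz, h'.2 z hz hpz] with r h1 h2
  exact z.injOn h1.1 h2.1 (sub_left_injective (h1.2.trans h2.2.symm))

theorem LocDev.comp {α β : Type*} {l : Filter α} {l' : Filter β} {f : α → X} {g : α → ℂ} {p : X}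
    (h : S.LocDev l f g p) {k : β → α} (hk : Tendsto k l' l) :
    S.LocDev l' (f ∘ k) (g ∘ k) p :=
  ⟨h.1, fun z hz hpz => hk.eventually (h.2 z hz hpz)⟩

theorem LocDev.congr {α : Type*} {l : Filter α} {f f' : α → X} {g g' : α → ℂ} {p : X}
    (h : S.LocDev l f g p) (hf : f =ᶠ[l] f') (hg : g =ᶠ[l] g') : S.LocDev l f' g' p :=
  ⟨h.1, fun z hz hpz => by
    filter_upwards [h.2 z hz hpz, hf, hg] with r h1 h2 h3
    rwa [← h2, ← h3]⟩

theorem LocDev.mono {α : Type*} {l l' : Filter α} {f : α → X} {g : α → ℂ} {p : X}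
    (h : S.LocDev l f g p) (hl : l' ≤ l) : S.LocDev l' f g p := h.comp (k := id) hl

theorem tendsto_displacement (v : ℂ) (J : Set ℝ) (s : ℝ) :
    Tendsto (fun r : ℝ => ((r - s : ℝ) : ℂ) * v) (𝓝[J] s) (𝓝 0) := by
  have : Continuous (fun r : ℝ => ((r - s : ℝ) : ℂ) * v) := by fun_prop
  simpa using (this.tendsto s).mono_left nhdsWithin_le_nhds

theorem IsStraight.locDev {v : ℂ} {c : ℝ → X} {J : Set ℝ} (hc : S.IsStraight v c J) {s : ℝ}
    (hs : s ∈ J) : S.LocDev (𝓝[J] s) c (fun r => ((r - s : ℝ) : ℂ) * v) (c s) := hc s hs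

theorem IsStraight.continuousOn {v : ℂ} {c : ℝ → X} {J : Set ℝ} (hc : S.IsStraight v c J) :
    ContinuousOn c J := fun s hs => (hc.locDev hs).tendsto (tendsto_displacement v J s)

theorem IsStraight.mono {v : ℂ} {c : ℝ → X} {J J' : Set ℝ} (hc : S.IsStraight v c J)
    (h : J' ⊆ J) : S.IsStraight v c J' :=
  fun s hs => (hc.locDev (h hs)).mono (nhdsWithin_mono s h)

theorem IsStraight.congr {v : ℂ} {c c' : ℝ → X} {J : Set ℝ} (hc : S.IsStraight v c J)
    (h : EqOn c c' J) : S.IsStraight v c' J := by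
  intro s hs
  rw [← h hs]
  exact (hc.locDev hs).congr (h.eventuallyEq_of_mem self_mem_nhdsWithin) .rfl

/-- Affine reparametrization of a straight curve. -/
theorem IsStraight.comp_affine {v : ℂ} {c : ℝ → X} {J : Set ℝ} (hc : S.IsStraight v c J)
    (k a : ℝ) : S.IsStraight (k * v) (fun t => c (k * t + a)) ((fun t => k * t + a) ⁻¹' J) := by
  intro s hs
  have h := (hc.locDev (s := k * s + a) hs).comp (k := fun t => k * t + a)
    (l' := 𝓝[(fun t => k * t + a) ⁻¹' J] s) ?_
  · refine h.congr .rfl (Eventually.of_forall fun r => ?_)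
    simp only [Function.comp]
    push_cast
    ring
  · refine tendsto_nhdsWithin_iff.2 ⟨?_, self_mem_nhdsWithin⟩
    have : Continuous (fun t : ℝ => k * t + a) := by fun_prop
    exact (this.tendsto s).mono_left nhdsWithin_le_nhds

/-- The coincidence set is open by uniqueness in charts, and closed because the space is Hausdorff.
-/
theorem IsStraight.eqOn [T2Space X] {v : ℂ} {c c' : ℝ → X} {J : Set ℝ}
    (hc : S.IsStraight v c J) (hc' : S.IsStraight v c' J) (hJ : IsPreconnected J) {s : ℝ}
    (hs : s ∈ J) (h : c s = c' s) : EqOn c c' J := by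
  intro t ht
  refine forall_of_locally_constant hJ (G := fun t => c t = c' t) ?_ hs ht h
  intro x hx
  by_cases hxe : c x = c' x
  · have h1 := hc.locDev hx
    have h2 := hc'.locDev hx
    rw [← hxe] at h2
    filter_upwards [h1.eventuallyEq h2] with y hy
    exact iff_of_true hxe hy
  · have := ((hc.continuousOn x hx).prodMk (hc'.continuousOn x hx)).eventually
      (isClosed_diagonal.isOpen_compl.mem_nhds (x := (c x, c' x)) hxe)
    filter_upwards [this] with y hy
    exact iff_of_false hxe hy

/-- A straight curve that is close to the centre of a coordinate stays in its domain for a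
definite time, and is a straight line there. -/
theorem IsStraight.stay [T2Space X] {v : ℂ} {c : ℝ → X} {J : Set ℝ}
    (hc : S.IsStraight v c J) (hJ : J.OrdConnected) {x : X} {m : ℕ}
    {ζ : OpenPartialHomeomorph X ℂ} (hζ : S.IsCoord x m ζ) {R : ℝ} (hR : 0 < R)
    (hball : Metric.closedBall 0 R ⊆ ζ.target) {t₀ t : ℝ} (ht₀ : t₀ ∈ J) (ht : t ∈ J)
    (hmem : c t₀ ∈ ζ.source) (hlt : ‖ζ (c t₀)‖ ^ m + |t - t₀| * ‖v‖ < R ^ m) :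
    c t ∈ ζ.source ∧ ‖ζ (c t)‖ < R ∧ ζ (c t) ^ m = ζ (c t₀) ^ m + ((t - t₀ : ℝ) : ℂ) * v := by
  have hsub : uIcc t₀ t ⊆ J := hJ.uIcc_subset ht₀ ht
  have hm : m ≠ 0 := by have := hζ.one_le; omega
  have key : ∀ r ∈ uIcc t₀ t, ζ (c r) ^ m = ζ (c t₀) ^ m + ((r - t₀ : ℝ) : ℂ) * v →
      ‖ζ (c r)‖ < R := by
    intro r hr h
    refine lt_of_pow_lt_pow_left₀ m hR.le ?_
    rw [← norm_pow, h]
    refine (norm_add_le _ _).trans_lt (lt_of_le_of_lt ?_ hlt)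
    rw [norm_pow, norm_mul, Complex.norm_real, Real.norm_eq_abs]
    have : |r - t₀| ≤ |t - t₀| := abs_sub_left_of_mem_uIcc hr
    gcongr
  have hcc : S.IsStraight v c (uIcc t₀ t) := hc.mono hsub
  have hK : IsClosed (ζ.symm '' Metric.closedBall 0 R) :=
    ((isCompact_closedBall 0 R).image_of_continuousOn
      (ζ.continuousOn_symm.mono hball)).isClosed
  have main : c t ∈ ζ.source ∧ ζ (c t) ^ m = ζ (c t₀) ^ m + ((t - t₀ : ℝ) : ℂ) * v := by
    refine forall_of_locally_constant isPreconnected_uIcc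
      (G := fun r => c r ∈ ζ.source ∧ ζ (c r) ^ m = ζ (c t₀) ^ m + ((r - t₀ : ℝ) : ℂ) * v)
      ?_ left_mem_uIcc right_mem_uIcc ⟨hmem, by simp⟩
    intro r hr
    have hloc := hcc.locDev hr
    have hdis := tendsto_displacement v (uIcc t₀ t) r
    have fwd : c r ∈ ζ.source → ∀ᶠ y in 𝓝[uIcc t₀ t] r,
        ((c r ∈ ζ.source ∧ ζ (c r) ^ m = ζ (c t₀) ^ m + ((r - t₀ : ℝ) : ℂ) * v) ↔
        (c y ∈ ζ.source ∧ ζ (c y) ^ m = ζ (c t₀) ^ m + ((y - t₀ : ℝ) : ℂ) * v)) := by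
      intro hcr
      filter_upwards [hloc.coord hdis hζ hcr] with y hy
      have : ζ (c y) ^ m = ζ (c r) ^ m + ((y - r : ℝ) : ℂ) * v := by rw [← hy.2]; ring
      constructor
      · rintro ⟨_, h⟩
        refine ⟨hy.1, ?_⟩
        rw [this, h]; push_cast; ring
      · rintro ⟨_, h⟩
        refine ⟨hcr, ?_⟩
        have h2 := this.symm.trans h
        push_cast at h2 ⊢
        linear_combination h2
    by_cases hcr : c r ∈ ζ.source
    · exact fwd hcr
    · by_contra hcon
      apply hcr
      -- The curve cannot leave the domain of `ζ` at `r`: nearby points lie in the image of the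
      -- closed disc, which is compact, hence closed in `X`, and contained in the domain.
      have hfr : ∃ᶠ y in 𝓝[uIcc t₀ t] r, c y ∈ ζ.symm '' Metric.closedBall 0 R := by
        refine (Filter.not_eventually.1 hcon |>.and_eventually self_mem_nhdsWithin).mono ?_
        rintro y ⟨hy, hyJ⟩
        have hG : c y ∈ ζ.source ∧ ζ (c y) ^ m = ζ (c t₀) ^ m + ((y - t₀ : ℝ) : ℂ) * v := by
          by_contra hn
          exact hy (iff_of_false (fun h => hcr h.1) hn)
        exact ⟨ζ (c y), by simpa using (key y hyJ hG.2).le, ζ.left_inv hG.1⟩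
      have := hK.mem_of_frequently_of_tendsto hfr (hcc.continuousOn r hr)
      obtain ⟨w, hw, hwe⟩ := this
      rw [← hwe]
      exact ζ.map_target (hball hw)
  exact ⟨main.1, key t right_mem_uIcc main.2, main.2⟩

end

/-! ### The straight-line flow -/

section

variable {X : Type*} [TopologicalSpace X] {S : TranslationSurface X}

theorem LocDev.sup {α : Type*} {l l' : Filter α} {f : α → X} {g : α → ℂ} {p : X}
    (h : S.LocDev l f g p) (h' : S.LocDev l' f g p) : S.LocDev (l ⊔ l') f g p :=
  ⟨h.1, fun z hz hpz => eventually_sup.2 ⟨h.2 z hz hpz, h'.2 z hz hpz⟩⟩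

theorem LocDev.of_bot {α : Type*} {f : α → X} {g : α → ℂ} {p : X} (hp : p ∉ S.sing) :
    S.LocDev ⊥ f g p := ⟨hp, fun _ _ _ => eventually_bot⟩

theorem IsCoord.exists_closedBall {p : X} {m : ℕ} {ζ : OpenPartialHomeomorph X ℂ}
    (hζ : S.IsCoord p m ζ) {ρ : ℝ} (hρ : 0 < ρ) :
    ∃ R, 0 < R ∧ R < ρ ∧ Metric.closedBall 0 R ⊆ ζ.target := by
  have h0 : (0 : ℂ) ∈ ζ.target := by rw [← hζ.map_self]; exact ζ.map_source hζ.mem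
  obtain ⟨ε, hε, hb⟩ := Metric.isOpen_iff.1 ζ.open_target 0 h0
  refine ⟨min ε ρ / 2, by positivity, ?_, (Metric.closedBall_subset_ball ?_).trans hb⟩
  · have := min_le_right ε ρ
    linarith
  · have := min_le_left ε ρ
    have : 0 < min ε ρ := by positivity
    linarith

theorem IsCoord.notMem_sing {p q : X} {m : ℕ} {ζ : OpenPartialHomeomorph X ℂ}
    (hζ : S.IsCoord p m ζ) (hp : p ∉ S.sing) (hq : q ∈ ζ.source) : q ∉ S.sing := by
  intro h
  rw [hζ.eq_of_sing q hq h] at h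
  exact hp h

variable (S) in
theorem exists_isCoord_one {p : X} (hp : p ∉ S.sing) : ∃ ζ, S.IsCoord p 1 ζ := by
  obtain ⟨m, ζ, hζ⟩ := S.exists_isCoord p
  obtain rfl := hζ.eq_one hp
  exact ⟨ζ, hζ⟩

theorem IsCoord.isStraight_line {p q : X} {ζ : OpenPartialHomeomorph X ℂ}
    (hζ : S.IsCoord p 1 ζ) (hp : p ∉ S.sing) {R : ℝ} (hball : Metric.closedBall 0 R ⊆ ζ.target)
    (v : ℂ) :
    S.IsStraight v (fun t : ℝ => ζ.symm (ζ q + t * v)) {t | ‖ζ q‖ + |t| * ‖v‖ < R} := by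
  have hmem : ∀ t ∈ {t : ℝ | ‖ζ q‖ + |t| * ‖v‖ < R}, ζ q + t * v ∈ ζ.target := by
    intro t ht
    refine hball ?_
    rw [mem_closedBall_zero_iff]
    refine (norm_add_le _ _).trans ?_
    rw [norm_mul, Complex.norm_real, Real.norm_eq_abs]
    exact le_of_lt ht
  intro s hs
  have hs' := ζ.map_target (hmem s hs)
  refine LocDev.of_coord hζ hs' (hζ.notMem_sing hp hs') (tendsto_displacement v _ s) ?_
  filter_upwards [self_mem_nhdsWithin] with r hr
  refine ⟨ζ.map_target (hmem r hr), ?_⟩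
  rw [ζ.right_inv (hmem r hr), ζ.right_inv (hmem s hs)]
  push_cast
  ring

variable (S) in
theorem exists_isStraight {p : X} (hp : p ∉ S.sing) (v : ℂ) :
    ∃ ε > 0, ∃ c : ℝ → X, c 0 = p ∧ S.IsStraight v c (Icc (-ε) ε) := by
  obtain ⟨ζ, hζ⟩ := S.exists_isCoord_one hp
  obtain ⟨R, hR, -, hb⟩ := hζ.exists_closedBall one_pos
  refine ⟨R / (2 * (‖v‖ + 1)), by positivity, _, ?_,
    (hζ.isStraight_line (q := p) hp hb v).mono ?_⟩
  · simp [ζ.left_inv hζ.mem]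
  · intro t ht
    have h1 : |t| ≤ R / (2 * (‖v‖ + 1)) := abs_le.2 ht
    have h2 : |t| * (2 * (‖v‖ + 1)) ≤ R := (le_div_iff₀ (by positivity)).1 h1
    simp only [hζ.map_self, norm_zero, zero_add, mem_ofPred_eq]
    nlinarith [norm_nonneg v, abs_nonneg t]

/-- The closure conditions say that each piece is relatively closed in the union, so a parameter
outside a piece has a neighbourhood that misses it. -/
theorem IsStraight.union_of_closure {v : ℂ} {c : ℝ → X} {J J' : Set ℝ}
    (h : S.IsStraight v c J) (h' : S.IsStraight v c J') (hJ : J ∩ closure J' ⊆ J')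
    (hJ' : J' ∩ closure J ⊆ J) : S.IsStraight v c (J ∪ J') := by
  have aux : ∀ {J J' : Set ℝ}, S.IsStraight v c J → S.IsStraight v c J' →
      J ∩ closure J' ⊆ J' → ∀ s ∈ J,
      S.LocDev (𝓝[J ∪ J'] s) c (fun r => ((r - s : ℝ) : ℂ) * v) (c s) := by
    intro J J' h h' hJ s hs
    rw [nhdsWithin_union]
    refine (h.locDev hs).sup ?_
    by_cases hs' : s ∈ closure J'
    · exact h'.locDev (hJ ⟨hs, hs'⟩)
    · rw [notMem_closure_iff_nhdsWithin_eq_bot.1 hs']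
      exact .of_bot (h s hs).1
  rintro s (hs | hs)
  · exact aux h h' hJ s hs
  · rw [union_comm]
    exact aux h' h hJ' s hs

theorem IsStraight.union_of_isOpen {v : ℂ} {c : ℝ → X} {J J' : Set ℝ}
    (h : S.IsStraight v c J) (h' : S.IsStraight v c J') (hJ : IsOpen J) (hJ' : IsOpen J') :
    S.IsStraight v c (J ∪ J') := by
  rintro s (hs | hs)
  · refine (h.locDev hs).mono ?_
    rw [hJ.nhdsWithin_eq hs]
    exact nhdsWithin_le_nhds
  · refine (h'.locDev hs).mono ?_
    rw [hJ'.nhdsWithin_eq hs]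
    exact nhdsWithin_le_nhds

theorem IsStraight.shift {v : ℂ} {c : ℝ → X} {J : Set ℝ} (hc : S.IsStraight v c J) (a : ℝ) :
    S.IsStraight v (fun t => c (t + a)) ((fun t => t + a) ⁻¹' J) := by
  simpa using hc.comp_affine 1 a

theorem IsStraight.exists_extend_right {v : ℂ} {c : ℝ → X} {a b : ℝ} (hab : a ≤ b)
    (hc : S.IsStraight v c (Icc a b)) :
    ∃ ε > 0, ∃ d : ℝ → X, EqOn d c (Icc a b) ∧ S.IsStraight v d (Icc a (b + ε)) := by
  obtain ⟨ε, hε, e, he0, he⟩ := S.exists_isStraight (hc b (right_mem_Icc.2 hab)).1 v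
  refine ⟨ε, hε, fun t => if t ≤ b then c t else e (t + -b), fun t ht => by simp [ht.2], ?_⟩
  rw [← Icc_union_Icc_eq_Icc hab (by linarith : b ≤ b + ε)]
  refine IsStraight.union_of_closure ?_ ?_ ?_ ?_
  · exact hc.congr fun t ht => by simp [ht.2]
  · refine ((he.shift (-b)).mono fun t ht => ?_).congr fun t ht => ?_
    · simp only [mem_preimage, mem_Icc] at ht ⊢
      constructor <;> linarith
    · rcases ht.1.eq_or_lt with rfl | h
      · simp [he0]
      · simp [h]
  · rw [closure_Icc]; exact inter_subset_right
  · rw [closure_Icc]; exact inter_subset_right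

theorem IsStraight.exists_extend {v : ℂ} {c : ℝ → X} {a b : ℝ} (hab : a ≤ b)
    (hc : S.IsStraight v c (Icc a b)) :
    ∃ ε > 0, ∃ d : ℝ → X, EqOn d c (Icc a b) ∧ S.IsStraight v d (Ioo (a - ε) (b + ε)) := by
  obtain ⟨ε, hε, d, hd, hds⟩ := hc.exists_extend_right hab
  have h1 : S.IsStraight (-v) (fun t => d (-t)) (Icc (-(b + ε)) (-a)) := by
    have := hds.comp_affine (-1) 0
    simp only [Complex.ofReal_neg, Complex.ofReal_one, neg_mul, one_mul, add_zero] at this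
    refine this.mono fun t ht => ?_
    simp only [mem_preimage, mem_Icc] at ht ⊢
    constructor <;> linarith
  obtain ⟨ε', hε', e, he, hes⟩ := h1.exists_extend_right (by linarith)
  refine ⟨min ε ε', by positivity, fun t => e (-t), fun t ht => ?_, ?_⟩
  · simp only
    rw [he (by simp only [mem_Icc] at ht ⊢; constructor <;> linarith)]
    simp only [neg_neg]
    exact hd ht
  · have := hes.comp_affine (-1) 0
    simp only [Complex.ofReal_neg, Complex.ofReal_one, neg_mul, one_mul, add_zero,
      neg_neg] at this
    refine this.mono fun t ht => ?_
    simp only [mem_preimage, mem_Icc, mem_Ioo] at ht ⊢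
    have h2 := min_le_left ε ε'
    have h3 := min_le_right ε ε'
    constructor <;> linarith

/-- Trajectories extend a little beyond both ends. Open parameter intervals make gluing painless and
show that `dom` is open. -/
theorem flow_iff {v : ℂ} {t : ℝ} {p q : X} : S.Flow v t p q ↔
    ∃ (c : ℝ → X) (U : Set ℝ), IsOpen U ∧ U.OrdConnected ∧ 0 ∈ U ∧ t ∈ U ∧ c 0 = p ∧ c t = q ∧
      S.IsStraight v c U := by
  constructor
  · rintro ⟨c, h0, ht, hc⟩
    obtain ⟨ε, hε, d, hd, hds⟩ := IsStraight.exists_extend (S := S) (min_le_max) hc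
    have hsub : uIcc 0 t ⊆ Ioo (min 0 t - ε) (max 0 t + ε) :=
      Icc_subset_Ioo (by linarith) (by linarith)
    exact ⟨d, _, isOpen_Ioo, ordConnected_Ioo, hsub left_mem_uIcc, hsub right_mem_uIcc,
      (hd left_mem_uIcc).trans h0, (hd right_mem_uIcc).trans ht, hds⟩
  · rintro ⟨c, U, -, hU, h0, ht, hc0, hct, hc⟩
    exact ⟨c, hc0, hct, hc.mono (hU.uIcc_subset h0 ht)⟩

theorem IsStraight.flow {v : ℂ} {c : ℝ → X} {J : Set ℝ} (hc : S.IsStraight v c J)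
    (hJ : J.OrdConnected) {a b : ℝ} (ha : a ∈ J) (hb : b ∈ J) :
    S.Flow v (b - a) (c a) (c b) := by
  refine ⟨fun t => c (t + a), by simp, by simp, (hc.shift a).mono fun t ht => ?_⟩
  refine hJ.uIcc_subset ha hb ?_
  have := mem_image_of_mem (fun x => x + a) ht
  rwa [image_add_const_uIcc, zero_add, sub_add_cancel] at this

theorem Flow.start_notMem {v : ℂ} {t : ℝ} {p q : X} (h : S.Flow v t p q) : p ∉ S.sing := by
  obtain ⟨c, rfl, -, hc⟩ := h
  exact (hc 0 left_mem_uIcc).1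

theorem Flow.end_notMem {v : ℂ} {t : ℝ} {p q : X} (h : S.Flow v t p q) : q ∉ S.sing := by
  obtain ⟨c, -, rfl, hc⟩ := h
  exact (hc t right_mem_uIcc).1

theorem flow_zero {v : ℂ} {p : X} (hp : p ∉ S.sing) : S.Flow v 0 p p := by
  obtain ⟨ε, hε, c, h0, hc⟩ := S.exists_isStraight hp v
  exact ⟨c, h0, h0, hc.mono (by rw [uIcc_self]; intro t ht; rw [ht]; constructor <;> linarith)⟩

theorem Flow.unique [T2Space X] {v : ℂ} {t : ℝ} {p q q' : X} (h : S.Flow v t p q)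
    (h' : S.Flow v t p q') : q = q' := by
  obtain ⟨c, h0, rfl, hc⟩ := h
  obtain ⟨c', h0', rfl, hc'⟩ := h'
  exact hc.eqOn hc' isPreconnected_uIcc left_mem_uIcc (h0.trans h0'.symm) right_mem_uIcc

theorem Flow.symm {v : ℂ} {t : ℝ} {p q : X} (h : S.Flow v t p q) : S.Flow v (-t) q p := by
  obtain ⟨c, rfl, rfl, hc⟩ := h
  simpa using hc.flow ordConnected_uIcc right_mem_uIcc left_mem_uIcc

theorem Flow.neg {v : ℂ} {t : ℝ} {p q : X} (h : S.Flow v t p q) : S.Flow (-v) (-t) p q := by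
  obtain ⟨c, rfl, rfl, hc⟩ := h
  refine ⟨fun t => c (-t), by simp, by simp, ?_⟩
  have := hc.comp_affine (-1) 0
  simp only [Complex.ofReal_neg, Complex.ofReal_one, neg_mul, one_mul, add_zero] at this
  refine this.mono fun r hr => ?_
  simp only [mem_preimage, mem_uIcc] at hr ⊢
  rcases hr with h | h
  · right; constructor <;> linarith
  · left; constructor <;> linarith

theorem flow_neg_iff {v : ℂ} {t : ℝ} {p q : X} : S.Flow (-v) (-t) p q ↔ S.Flow v t p q :=
  ⟨fun h => by simpa using h.neg, Flow.neg⟩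

/-- After a shift in time both curves pass through `q` at time `t`, so they agree on the overlap of
their parameter intervals and can be glued, whatever the signs of `t` and `t'`. -/
theorem Flow.trans [T2Space X] {v : ℂ} {t t' : ℝ} {p q r : X} (h : S.Flow v t p q)
    (h' : S.Flow v t' q r) : S.Flow v (t + t') p r := by
  obtain ⟨c, U, hU, hUc, h0, ht, rfl, rfl, hc⟩ := flow_iff.1 h
  obtain ⟨c', U', hU', hUc', h0', ht', h0c', rfl, hc'⟩ := flow_iff.1 h'
  set V : Set ℝ := (fun x => x + -t) ⁻¹' U' with hV
  have hVo : IsOpen V := hU'.preimage (by fun_prop)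
  have hVc : V.OrdConnected := hUc'.preimage_mono (fun a b hab => by simpa using hab)
  have hd := hc'.shift (-t)
  have htV : t ∈ V := by simpa [hV] using h0'
  have heq : EqOn c (fun x => c' (x + -t)) (U ∩ V) :=
    (hc.mono inter_subset_left).eqOn (hd.mono inter_subset_right)
      (hUc.inter hVc).isPreconnected ⟨ht, htV⟩ (by simp [h0c'])
  classical
  refine flow_iff.2 ⟨fun x => if x ∈ U then c x else c' (x + -t), U ∪ V, hU.union hVo,
    (isPreconnected_iff_ordConnected.1
      (IsPreconnected.union t ht htV hUc.isPreconnected hVc.isPreconnected)), Or.inl h0,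
      Or.inr (by simpa [hV] using ht'), by simp [h0], ?_, ?_⟩
  · by_cases hm : t + t' ∈ U
    · have := heq ⟨hm, by simpa [hV] using ht'⟩
      simpa [hm] using this
    · simp [hm]
  · refine IsStraight.union_of_isOpen ?_ ?_ hU hVo
    · exact hc.congr fun x hx => by simp [hx]
    · refine hd.congr fun x hx => ?_
      by_cases hm : x ∈ U
      · simpa [hm] using (heq ⟨hm, hx⟩).symm
      · simp [hm]

/-- A trajectory can be stopped at an intermediate time. -/
theorem Flow.exists_of_mem {v : ℂ} {t s : ℝ} {p q : X} (h : S.Flow v t p q)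
    (hs : s ∈ uIcc 0 t) : ∃ r, S.Flow v s p r := by
  obtain ⟨c, rfl, rfl, hc⟩ := h
  exact ⟨c s, by simpa using hc.flow ordConnected_uIcc left_mem_uIcc hs⟩

/-- Two trajectories that end at the same point. -/
theorem Flow.flow_sub [T2Space X] {v : ℂ} {t t' : ℝ} {p p' q : X} (h : S.Flow v t p q)
    (h' : S.Flow v t' p' q) : S.Flow v (t - t') p p' := by
  simpa [sub_eq_add_neg] using h.trans h'.symm

theorem flow_zero_iff [T2Space X] {v : ℂ} {p q : X} (h : S.Flow v 0 p q) : p = q :=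
  (flow_zero h.start_notMem).unique h

variable (S) in
open Classical in
/-- The point reached from `p` at time `t` by the flow with velocity `v` (or `p` itself, if the
trajectory does not last until `t`). -/
noncomputable def fl (v : ℂ) (p : X) (t : ℝ) : X :=
  if h : ∃ q, S.Flow v t p q then h.choose else p

theorem Flow.fl_eq [T2Space X] {v : ℂ} {t : ℝ} {p q : X} (h : S.Flow v t p q) :
    S.fl v p t = q := by
  have h' : ∃ q, S.Flow v t p q := ⟨q, h⟩
  rw [fl, dif_pos h']
  exact h'.choose_spec.unique h

variable (S) in
/-- The times at which the trajectory of `p` is defined. -/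
def dom (v : ℂ) (p : X) : Set ℝ := {t | ∃ q, S.Flow v t p q}

theorem flow_fl [T2Space X] {v : ℂ} {t : ℝ} {p : X} (h : t ∈ S.dom v p) :
    S.Flow v t p (S.fl v p t) := by
  obtain ⟨q, hq⟩ := h
  rwa [hq.fl_eq]

theorem ordConnected_dom (v : ℂ) (p : X) : (S.dom v p).OrdConnected := by
  refine ordConnected_of_uIcc_subset_left (x := 0) ?_
  rintro t ⟨q, hq⟩ s hs
  exact hq.exists_of_mem hs

theorem zero_mem_dom {v : ℂ} {p : X} (hp : p ∉ S.sing) : 0 ∈ S.dom v p := ⟨p, flow_zero hp⟩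

theorem fl_zero [T2Space X] {v : ℂ} {p : X} (hp : p ∉ S.sing) : S.fl v p 0 = p :=
  (flow_zero hp).fl_eq

theorem exists_isOpen_eqOn_fl [T2Space X] {v : ℂ} {p : X} {t : ℝ} (ht : t ∈ S.dom v p) :
    ∃ U, IsOpen U ∧ t ∈ U ∧ U ⊆ S.dom v p ∧ S.IsStraight v (S.fl v p) U := by
  obtain ⟨q, hq⟩ := ht
  obtain ⟨c, U, hU, hUc, h0, ht, rfl, rfl, hc⟩ := flow_iff.1 hq
  have : ∀ x ∈ U, S.Flow v x (c 0) (c x) := fun x hx => by simpa using hc.flow hUc h0 hx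
  exact ⟨U, hU, ht, fun x hx => ⟨_, this x hx⟩, hc.congr fun x hx => (this x hx).fl_eq.symm⟩

theorem isOpen_dom [T2Space X] (v : ℂ) (p : X) : IsOpen (S.dom v p) := by
  refine isOpen_iff_mem_nhds.2 fun t ht => ?_
  obtain ⟨U, hU, htU, hUs, -⟩ := exists_isOpen_eqOn_fl ht
  exact mem_of_superset (hU.mem_nhds htU) hUs

theorem isStraight_fl [T2Space X] (v : ℂ) (p : X) :
    S.IsStraight v (S.fl v p) (S.dom v p) := by
  intro t ht
  obtain ⟨U, hU, htU, -, h⟩ := exists_isOpen_eqOn_fl ht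
  refine (h.locDev htU).mono ?_
  rw [hU.nhdsWithin_eq htU]
  exact nhdsWithin_le_nhds

end

/-! ### Falling into a singularity -/

section

variable {X : Type*} [TopologicalSpace X] {S : TranslationSurface X}

theorem IsCoord.tendsto_of_norm {α : Type*} {l : Filter α} {f : α → X} {p : X} {m : ℕ}
    {ζ : OpenPartialHomeomorph X ℂ} (hζ : S.IsCoord p m ζ)
    (h : ∀ ρ > 0, ∀ᶠ r in l, f r ∈ ζ.source ∧ ‖ζ (f r)‖ < ρ) : Tendsto f l (𝓝 p) := by
  have h1 : Tendsto (fun r => ζ (f r)) l (𝓝 (ζ p)) := by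
    rw [hζ.map_self]
    refine Metric.tendsto_nhds.2 fun ε hε => ?_
    filter_upwards [h ε hε] with r hr
    simpa using hr.2
  have h2 := (ζ.continuousAt_symm (ζ.map_source hζ.mem)).tendsto.comp h1
  rw [ζ.left_inv hζ.mem] at h2
  refine h2.congr' ?_
  filter_upwards [h 1 one_pos] with r hr
  exact ζ.left_inv hr.1

theorem IsCoord.eventually_norm_lt {p : X} {m : ℕ} {ζ : OpenPartialHomeomorph X ℂ}
    (hζ : S.IsCoord p m ζ) {ρ : ℝ} (hρ : 0 < ρ) :
    ∀ᶠ q in 𝓝 p, q ∈ ζ.source ∧ ‖ζ q‖ ^ m < ρ := by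
  have hm : m ≠ 0 := by have := hζ.one_le; omega
  have h1 : Tendsto (fun q => ‖ζ q‖ ^ m) (𝓝 p) (𝓝 0) := by
    have := ((continuous_pow m).tendsto _).comp (ζ.continuousAt hζ.mem).norm.tendsto
    simpa [hζ.map_self, hm, Function.comp_def] using this
  filter_upwards [ζ.open_source.mem_nhds hζ.mem, h1.eventually (gt_mem_nhds hρ)] with q h2 h3
  exact ⟨h2, h3⟩

theorem isClosed_sing : IsClosed S.sing := by
  refine isOpen_compl_iff.1 (isOpen_iff_mem_nhds.2 fun p hp => ?_)
  obtain ⟨z, hz, hpz⟩ := S.charts_cover p hp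
  exact mem_of_superset (z.open_source.mem_nhds hpz) (S.charts_regular z hz)

/-- The set is closed, hence compact, and a coordinate centred at a singularity contains no other.
-/
theorem finite_sing [CompactSpace X] : S.sing.Finite := by
  refine inter_self S.sing ▸ (isClosed_sing (S := S)).isCompact.induction_on
    (p := fun U => (S.sing ∩ U).Finite) (by simp)
    (fun s t hst ht => ht.subset (inter_subset_inter_right _ hst))
    (fun s t hs ht => by rw [inter_union_distrib_left]; exact hs.union ht) fun b hb => ?_
  obtain ⟨m, ζ, hζ⟩ := S.exists_isCoord b
  exact ⟨ζ.source, mem_nhdsWithin_of_mem_nhds (ζ.open_source.mem_nhds hζ.mem),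
    (finite_singleton b).subset fun q hq => hζ.eq_of_sing q hq.2 hq.1⟩

variable (S) in
/-- The flow with velocity `v` drops `p` into the singularity `b` at time `T`. -/
def FallsTo (v : ℂ) (T : ℝ) (p b : X) : Prop :=
  0 < T ∧ b ∈ S.sing ∧ Ico 0 T ⊆ S.dom v p ∧ Tendsto (S.fl v p) (𝓝[<] T) (𝓝 b)

variable (S) in
/-- The flow with velocity `v` drops `p` into a singularity at time `T`. -/
def Falls (v : ℂ) (T : ℝ) (p : X) : Prop := ∃ b, S.FallsTo v T p b

theorem FallsTo.start_notMem {v : ℂ} {T : ℝ} {p b : X} (h : S.FallsTo v T p b) : p ∉ S.sing := by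
  obtain ⟨q, hq⟩ := h.2.2.1 (left_mem_Ico.2 h.1)
  exact hq.start_notMem

section
variable [T2Space X]

theorem mem_critical_iff {v : ℂ} {p : X} : p ∈ S.critical v ↔ ∃ T, S.Falls v T p := by
  constructor
  · rintro ⟨T, hT, b, hb, c, rfl, hc, hlim⟩
    have hfl : ∀ t ∈ Ico 0 T, S.Flow v t (c 0) (c t) := fun t ht => by
      simpa using hc.flow ordConnected_Ico (left_mem_Ico.2 hT) ht
    refine ⟨T, b, hT, hb, fun t ht => ⟨_, hfl t ht⟩, hlim.congr' ?_⟩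
    filter_upwards [Ico_mem_nhdsLT hT] with t ht
    exact (hfl t ht).fl_eq.symm
  · rintro ⟨T, b, h⟩
    exact ⟨T, h.1, b, h.2.1, S.fl v p, fl_zero h.start_notMem,
      (isStraight_fl v p).mono h.2.2.1, h.2.2.2⟩

theorem FallsTo.notMem_dom {v : ℂ} {T : ℝ} {p b : X} (h : S.FallsTo v T p b) :
    T ∉ S.dom v p := by
  intro hT
  have h1 := ((isStraight_fl v p).continuousOn.continuousAt ((isOpen_dom v p).mem_nhds hT)).tendsto
  have h2 := tendsto_nhds_unique (h1.mono_left nhdsWithin_le_nhds) h.2.2.2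
  exact (flow_fl hT).end_notMem (h2 ▸ h.2.1)

theorem FallsTo.lt_of_mem_dom {v : ℂ} {T t : ℝ} {p b : X} (h : S.FallsTo v T p b)
    (ht : t ∈ S.dom v p) : t < T := by
  by_contra! hlt
  refine h.notMem_dom ((ordConnected_dom v p).uIcc_subset (zero_mem_dom h.start_notMem) ht ?_)
  rw [uIcc_of_le (h.1.le.trans hlt)]
  exact ⟨h.1.le, hlt⟩

/-- A trajectory falling into `b`, seen in a coordinate centred at `b`. -/
theorem FallsTo.coord {v : ℂ} {T : ℝ} {p b : X} (h : S.FallsTo v T p b) {m : ℕ}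
    {ζ : OpenPartialHomeomorph X ℂ} (hζ : S.IsCoord b m ζ) {R : ℝ} (hR : 0 < R)
    (hball : Metric.closedBall 0 R ⊆ ζ.target) {t : ℝ} (ht : t ∈ Ico 0 T)
    (hlt : (T - t) * ‖v‖ < R ^ m) :
    S.fl v p t ∈ ζ.source ∧ ‖ζ (S.fl v p t)‖ < R ∧
      ζ (S.fl v p t) ^ m = ((t - T : ℝ) : ℂ) * v := by
  have hm : m ≠ 0 := by have := hζ.one_le; omega
  have hstr : S.IsStraight v (S.fl v p) (Ico 0 T) := (isStraight_fl v p).mono h.2.2.1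
  have hζlim : Tendsto (fun r => ζ (S.fl v p r) ^ m) (𝓝[<] T) (𝓝 0) := by
    have := (((continuous_pow m).tendsto _).comp (ζ.continuousAt hζ.mem).tendsto).comp h.2.2.2
    simpa [hζ.map_self, hm, Function.comp_def] using this
  have hid : Tendsto (fun r : ℝ => r) (𝓝[<] T) (𝓝 T) := nhdsWithin_le_nhds
  have hlim : Tendsto (fun r => ‖ζ (S.fl v p r)‖ ^ m + |t - r| * ‖v‖) (𝓝[<] T)
      (𝓝 (0 + |t - T| * ‖v‖)) := by
    refine Tendsto.add ?_ (((tendsto_const_nhds.sub hid).abs).mul_const _)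
    simpa using hζlim.norm
  have hlt' : 0 + |t - T| * ‖v‖ < R ^ m := by
    rwa [zero_add, abs_sub_comm, abs_of_pos (sub_pos.2 ht.2)]
  -- Compare with a later time `r`, when the trajectory is already near `b`, and then let `r` tend
  -- to `T`.
  have hev : ∀ᶠ r in 𝓝[<] T, S.fl v p t ∈ ζ.source ∧ ‖ζ (S.fl v p t)‖ < R ∧
      ζ (S.fl v p t) ^ m = ζ (S.fl v p r) ^ m + ((t - r : ℝ) : ℂ) * v := by
    filter_upwards [hlim.eventually (gt_mem_nhds hlt'), Ico_mem_nhdsLT h.1,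
      h.2.2.2.eventually (ζ.open_source.mem_nhds hζ.mem)] with r h1 h2 h3
    exact hstr.stay ordConnected_Ico hζ hR hball h2 ht h3 h1
  obtain ⟨r, hr⟩ := hev.exists
  refine ⟨hr.1, hr.2.1, ?_⟩
  have hlim2 : Tendsto (fun r => ζ (S.fl v p r) ^ m + ((t - r : ℝ) : ℂ) * v) (𝓝[<] T)
      (𝓝 (0 + ((t - T : ℝ) : ℂ) * v)) :=
    hζlim.add (((Complex.continuous_ofReal.tendsto _).comp
      (tendsto_const_nhds.sub hid)).mul_const _)
  rw [zero_add] at hlim2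
  exact tendsto_nhds_unique (tendsto_const_nhds.congr' (hev.mono fun r hr => hr.2.2)) hlim2

/-- A trajectory either lasts until a given time or falls into a singularity before. -/
theorem mem_dom_or_falls [CompactSpace X] {v : ℂ} {p : X} (hp : p ∉ S.sing) {T : ℝ} (hT : 0 ≤ T) :
    T ∈ S.dom v p ∨ ∃ T' ≤ T, S.Falls v T' p := by
  refine or_iff_not_imp_left.2 fun hTd => ?_
  obtain ⟨T', ⟨hT'd, hT'⟩, hleast⟩ : ∃ T', IsLeast ((S.dom v p)ᶜ ∩ Icc 0 T) T' :=
    (isCompact_Icc.inter_left (isOpen_dom v p).isClosed_compl).exists_isLeast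
      ⟨T, hTd, hT, le_rfl⟩
  have hpos : 0 < T' := hT'.1.lt_of_ne fun h => hT'd (h ▸ zero_mem_dom hp)
  have hsub : Ico 0 T' ⊆ S.dom v p := fun t ht => by
    by_contra h
    exact absurd (hleast ⟨h, ht.1, ht.2.le.trans hT'.2⟩) (not_le.2 ht.2)
  have hstr : S.IsStraight v (S.fl v p) (Ico 0 T') := (isStraight_fl v p).mono hsub
  refine ⟨T', hT'.2, ?_⟩
  -- A cluster point of the trajectory at the first missing time `T'`. If it is singular, the
  -- trajectory, once close, stays close and so converges to it; if it is regular, its chart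
  -- continues the trajectory through `T'`, a contradiction.
  obtain ⟨x, hx⟩ := exists_clusterPt_of_compactSpace (map (S.fl v p) (𝓝[<] T'))
  have hfreq : ∀ {P : X → Prop}, (∀ᶠ q in 𝓝 x, P q) → ∃ᶠ t in 𝓝[<] T', P (S.fl v p t) :=
    fun h => (mapClusterPt_iff_frequently.1 hx) _ h
  have hsmall : ∀ ρ > 0, ∀ᶠ t in 𝓝[<] T', (T' - t) * ‖v‖ < ρ := by
    intro ρ hρ
    have hid : Tendsto (fun r : ℝ => (T' - r) * ‖v‖) (𝓝[<] T') (𝓝 ((T' - T') * ‖v‖)) :=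
      (tendsto_const_nhds.sub (tendsto_id.mono_left nhdsWithin_le_nhds)).mul_const _
    rw [sub_self, zero_mul] at hid
    exact hid.eventually (gt_mem_nhds hρ)
  by_cases hxs : x ∈ S.sing
  · refine ⟨x, hpos, hxs, hsub, ?_⟩
    obtain ⟨m, ζ, hζ⟩ := S.exists_isCoord x
    refine hζ.tendsto_of_norm fun ρ hρ => ?_
    obtain ⟨R, hR, hRρ, hball⟩ := hζ.exists_closedBall hρ
    have hRm : 0 < R ^ m / 2 := by positivity
    obtain ⟨r, ⟨h1, h2⟩, h3⟩ := ((hfreq (hζ.eventually_norm_lt hRm)).and_eventually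
      ((hsmall _ hRm).and (Ico_mem_nhdsLT hpos))).exists
    filter_upwards [Ico_mem_nhdsLT h3.2.2] with t ht
    have := hstr.stay ordConnected_Ico hζ hR hball h3.2 ⟨h3.2.1.trans ht.1, ht.2⟩ h1 ?_
    · exact ⟨this.1, this.2.1.trans hRρ⟩
    · have : |t - r| * ‖v‖ ≤ (T' - r) * ‖v‖ := by
        rw [abs_of_nonneg (sub_nonneg.2 ht.1)]
        have := ht.2.le
        gcongr
      linarith [h3.1]
  · exfalso
    apply hT'd
    obtain ⟨ζ, hζ⟩ := S.exists_isCoord_one hxs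
    obtain ⟨R, hR, -, hball⟩ := hζ.exists_closedBall one_pos
    obtain ⟨r, ⟨h1, h2⟩, h3⟩ := ((hfreq (hζ.eventually_norm_lt (half_pos hR))).and_eventually
      ((hsmall _ (half_pos hR)).and (Ico_mem_nhdsLT hpos))).exists
    have hflow : S.Flow v (T' - r) (S.fl v p r)
        (ζ.symm (ζ (S.fl v p r) + ((T' - r : ℝ) : ℂ) * v)) := by
      refine ⟨_, ?_, rfl,
        (hζ.isStraight_line (q := S.fl v p r) hxs hball v).mono fun t ht => ?_⟩
      · simp [ζ.left_inv h1]
      · have h4 : |t| ≤ T' - r := by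
          have := abs_sub_left_of_mem_uIcc ht
          simpa [abs_of_pos (sub_pos.2 h3.2.2)] using this
        have : |t| * ‖v‖ ≤ (T' - r) * ‖v‖ := by gcongr
        simp only [mem_ofPred_eq]
        rw [pow_one] at h2
        linarith [h3.1]
    have := (flow_fl (hsub h3.2)).trans hflow
    rw [add_sub_cancel] at this
    exact ⟨_, this⟩

/-- The trajectories from a compact set of regular points which fall into singularities
do so through finitely many gates, which they pass a fixed time before falling. -/
theorem exists_gates [CompactSpace X] {v : ℂ} {H : Set X} (hH : IsClosed H)
    (hHs : Disjoint H S.sing) : ∃ η > 0, ∃ Ξ : Set X, Ξ.Finite ∧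
    ∀ p ∈ H, ∀ T, S.Falls v T p → η < T ∧ ∃ x ∈ Ξ, S.Flow v (T - η) p x := by
  have key : ∀ b ∈ S.sing, ∀ᶠ η : ℝ in 𝓝[>] 0, ∃ Ξ : Set X, Ξ.Finite ∧
      ∀ p ∈ H, ∀ T, S.FallsTo v T p b → η < T ∧ ∃ x ∈ Ξ, S.Flow v (T - η) p x := by
    intro b hb
    obtain ⟨m, ζ, hζ⟩ := S.exists_isCoord b
    have hm : 0 < m := by have := hζ.one_le; omega
    have hbH : Hᶜ ∈ 𝓝 b := hH.isOpen_compl.mem_nhds fun h => disjoint_left.1 hHs h hb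
    have h0 : ζ.symm 0 = b := by rw [← hζ.map_self, ζ.left_inv hζ.mem]
    have h0t : (0 : ℂ) ∈ ζ.target := by rw [← hζ.map_self]; exact ζ.map_source hζ.mem
    have hc := (ζ.continuousAt_symm h0t).tendsto
    rw [h0] at hc
    obtain ⟨ρ, hρ, hρH⟩ := Metric.mem_nhds_iff.1 (hc hbH)
    obtain ⟨R, hR, hRρ, hball⟩ := hζ.exists_closedBall hρ
    have hev : ∀ᶠ η : ℝ in 𝓝[>] 0, η * ‖v‖ < R ^ m := by
      have : Tendsto (fun η : ℝ => η * ‖v‖) (𝓝[>] 0) (𝓝 (0 * ‖v‖)) :=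
        Tendsto.mul_const _ nhdsWithin_le_nhds
      rw [zero_mul] at this
      exact this.eventually (gt_mem_nhds (by positivity))
    filter_upwards [hev, self_mem_nhdsWithin] with η hη hη0
    -- At time `η` before the fall the coordinate is an `m`-th root of `-η v`, which leaves at most
    -- `m` points.
    refine ⟨ζ.symm '' {w | w ^ m = ((-η : ℝ) : ℂ) * v}, Finite.image _ ?_, ?_⟩
    · refine (Polynomial.nthRoots m (((-η : ℝ) : ℂ) * v)).toFinset.finite_toSet.subset ?_
      intro w hw
      simpa [Polynomial.mem_nthRoots hm] using hw
    · intro p hp T hT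
      -- A trajectory falling within time `η` would start in the disc about `b` that was chosen
      -- disjoint from `H`.
      have hηT : η < T := by
        by_contra! hle
        have h1 : (T - 0) * ‖v‖ < R ^ m := by
          refine lt_of_le_of_lt ?_ hη
          rw [sub_zero]
          gcongr
        have h2 := hT.coord hζ hR hball (left_mem_Ico.2 hT.1) h1
        rw [fl_zero hT.start_notMem] at h2
        have h3 : ζ p ∈ ζ.symm ⁻¹' Hᶜ := hρH (by simpa using h2.2.1.trans hRρ)
        rw [mem_preimage, ζ.left_inv h2.1] at h3
        exact h3 hp
      have hmem : T - η ∈ Ico 0 T := ⟨by linarith, by linarith [mem_Ioi.1 hη0]⟩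
      have h2 := hT.coord hζ hR hball hmem (by rwa [sub_sub_cancel])
      refine ⟨hηT, _, ⟨ζ (S.fl v p (T - η)), ?_, ζ.left_inv h2.1⟩, flow_fl (hT.2.2.1 hmem)⟩
      simpa using h2.2.2
  obtain ⟨η, hη, hη0⟩ := (((eventually_all_finite (finite_sing (S := S))).2 key).and
    self_mem_nhdsWithin).exists
  choose! Ξ hΞ hgate using hη
  refine ⟨η, hη0, ⋃ b ∈ S.sing, Ξ b, finite_sing.biUnion hΞ, ?_⟩
  rintro p hp T ⟨b, hT⟩
  obtain ⟨h1, x, hx, h2⟩ := hgate b hT.2.1 p hp T hT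
  exact ⟨h1, x, mem_biUnion hT.2.1 hx, h2⟩

end

end

/-! ### Horizontal segments -/

section

variable {X : Type*} [TopologicalSpace X] {S : TranslationSurface X}

theorem IsCoord.exists_closedBall_of_mem_nhds {p : X} {m : ℕ} {ζ : OpenPartialHomeomorph X ℂ}
    (hζ : S.IsCoord p m ζ) {U : Set X} (hU : U ∈ 𝓝 p) :
    ∃ R > 0, Metric.closedBall 0 R ⊆ ζ.target ∧ ∀ q ∈ ζ.source, ‖ζ q‖ < R → q ∈ U := by
  have h0 : ζ.symm 0 = p := by rw [← hζ.map_self, ζ.left_inv hζ.mem]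
  have h0t : (0 : ℂ) ∈ ζ.target := by rw [← hζ.map_self]; exact ζ.map_source hζ.mem
  have hc := (ζ.continuousAt_symm h0t).tendsto
  rw [h0] at hc
  obtain ⟨ρ, hρ, hρU⟩ := Metric.mem_nhds_iff.1 (hc hU)
  obtain ⟨R, hR, hRρ, hball⟩ := hζ.exists_closedBall hρ
  refine ⟨R, hR, hball, fun q hq hqR => ?_⟩
  have h3 : ζ q ∈ ζ.symm ⁻¹' U := hρU (by simpa using hqR.trans hRρ)
  rwa [mem_preimage, ζ.left_inv hq] at h3

/-- Points of a horizontal segment in a coordinate. -/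
theorem IsStraight.eventually_horizontal {h : ℝ → X} {J : Set ℝ} (hh : S.IsStraight 1 h J) {s : ℝ}
    (hs : s ∈ J) {x : X} {ζ : OpenPartialHomeomorph X ℂ} (hζ : S.IsCoord x 1 ζ)
    (hx : h s = x) : ∀ᶠ r in 𝓝[J] s, h r ∈ ζ.source ∧ ζ (h r) = ((r - s : ℝ) : ℂ) := by
  filter_upwards [(hh.locDev hs).coord (tendsto_displacement 1 J s) hζ (hx ▸ hζ.mem)] with r hr
  refine ⟨hr.1, ?_⟩
  have := hr.2
  rwa [hx, hζ.map_self, pow_one, pow_one, sub_zero, mul_one] at this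

theorem disjoint_image_sing {v : ℂ} {h : ℝ → X} {J : Set ℝ} (hh : S.IsStraight v h J) :
    Disjoint (h '' J) S.sing := by
  rw [disjoint_left]
  rintro _ ⟨s, hs, rfl⟩
  exact (hh s hs).1

variable [T2Space X]

theorem Flow.stay {v : ℂ} {t : ℝ} {p q x : X} (h : S.Flow v t p q) {m : ℕ}
    {ζ : OpenPartialHomeomorph X ℂ} (hζ : S.IsCoord x m ζ) {R : ℝ} (hR : 0 < R)
    (hball : Metric.closedBall 0 R ⊆ ζ.target) (hp : p ∈ ζ.source)
    (hlt : ‖ζ p‖ ^ m + |t| * ‖v‖ < R ^ m) :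
    q ∈ ζ.source ∧ ‖ζ q‖ < R ∧ ζ q ^ m = ζ p ^ m + (t : ℂ) * v := by
  obtain ⟨c, rfl, rfl, hc⟩ := h
  simpa using hc.stay ordConnected_uIcc hζ hR hball left_mem_uIcc right_mem_uIcc hp
    (by simpa using hlt)

/-- A horizontal segment does not return to itself within short time. -/
theorem exists_min_return {h : ℝ → X} {J : Set ℝ} (hJ : IsCompact J) (hh : S.IsStraight 1 h J)
    {v : ℂ} (hv : v.im ≠ 0) :
    ∃ δ > 0, ∀ s ∈ J, ∀ s' ∈ J, ∀ τ ∈ Ioo 0 δ, ¬ S.Flow v τ (h s) (h s') := by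
  suffices ∃ δ > 0, ∀ u ∈ J ×ˢ J, ∀ τ ∈ Ioo 0 δ, ¬ S.Flow v τ (h u.1) (h u.2) by
    obtain ⟨δ, hδ, H⟩ := this
    exact ⟨δ, hδ, fun s hs s' hs' => H (s, s') ⟨hs, hs'⟩⟩
  refine (hJ.prod hJ).induction_on
    (p := fun W => ∃ δ > 0, ∀ u ∈ W, ∀ τ ∈ Ioo 0 δ, ¬ S.Flow v τ (h u.1) (h u.2))
    ⟨1, one_pos, by simp⟩ ?_ ?_ ?_
  · rintro W W' hW ⟨δ, hδ, H⟩
    exact ⟨δ, hδ, fun u hu => H u (hW hu)⟩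
  · rintro W W' ⟨δ, hδ, H⟩ ⟨δ', hδ', H'⟩
    refine ⟨min δ δ', lt_min hδ hδ', ?_⟩
    rintro u (hu | hu) τ hτ
    · exact H u hu τ ⟨hτ.1, hτ.2.trans_le (min_le_left _ _)⟩
    · exact H' u hu τ ⟨hτ.1, hτ.2.trans_le (min_le_right _ _)⟩
  rintro ⟨a, b⟩ ⟨ha, hb⟩
  obtain ⟨ζ, hζ⟩ := S.exists_isCoord_one (hh a ha).1
  suffices ∃ R > 0, Metric.closedBall 0 R ⊆ ζ.target ∧ ∀ᶠ s' in 𝓝[J] b, ∀ s, ∀ τ : ℝ,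
      τ ≠ 0 → ζ (h s) = ((s - a : ℝ) : ℂ) → h s' ∈ ζ.source → ‖ζ (h s')‖ < R →
      ζ (h s') = ζ (h s) + (τ : ℂ) * v → False by
    obtain ⟨R, hR, hball, hev⟩ := this
    have h1 : ∀ᶠ s in 𝓝[J] a, h s ∈ ζ.source ∧ ζ (h s) = ((s - a : ℝ) : ℂ) ∧ |s - a| < R / 2 := by
      filter_upwards [hh.eventually_horizontal ha hζ rfl,
        mem_nhdsWithin_of_mem_nhds (Metric.ball_mem_nhds a (half_pos hR))] with s hs hs'
      exact ⟨hs.1, hs.2, hs'⟩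
    refine ⟨{u | (h u.1 ∈ ζ.source ∧ ζ (h u.1) = ((u.1 - a : ℝ) : ℂ) ∧ |u.1 - a| < R / 2) ∧
        ∀ s, ∀ τ : ℝ, τ ≠ 0 → ζ (h s) = ((s - a : ℝ) : ℂ) → h u.2 ∈ ζ.source →
        ‖ζ (h u.2)‖ < R → ζ (h u.2) = ζ (h s) + (τ : ℂ) * v → False}, ?_,
      R / (2 * (‖v‖ + 1)), by positivity, ?_⟩
    · rw [nhdsWithin_prod_eq]
      exact h1.prod_mk hev
    · rintro u ⟨⟨h2, h3, h4⟩, h5⟩ τ hτ hfl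
      have h6 := hfl.stay hζ hR hball h2 ?_
      · rw [pow_one, pow_one] at h6
        exact h5 u.1 τ hτ.1.ne' h3 h6.1 h6.2.1 h6.2.2
      · have h7 : τ * (2 * (‖v‖ + 1)) < R := (lt_div_iff₀ (by positivity)).1 hτ.2
        rw [pow_one, pow_one, h3, Complex.norm_real, Real.norm_eq_abs, abs_of_pos hτ.1]
        nlinarith [hτ.1, norm_nonneg v]
  -- If `h a = h b`, both ends are on the same horizontal line of the coordinate, whereas `τ v` has
  -- a nonzero imaginary part. Otherwise `h a` and `h b` have disjoint neighbourhoods, and a short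
  -- trajectory does not leave that of `h a`.
  by_cases hab : h b = h a
  · obtain ⟨R, hR, -, hball⟩ := hζ.exists_closedBall one_pos
    refine ⟨R, hR, hball, ?_⟩
    filter_upwards [hh.eventually_horizontal hb hζ hab] with s' hs' s τ hτ h1 _ _ h2
    rw [hs'.2, h1] at h2
    have := congrArg Complex.im h2
    simp [hτ, hv] at this
  · obtain ⟨U, V, hU, hV, haU, hbV, hUV⟩ := t2_separation (Ne.symm hab)
    obtain ⟨R, hR, hball, hRU⟩ := hζ.exists_closedBall_of_mem_nhds (hU.mem_nhds haU)
    refine ⟨R, hR, hball, ?_⟩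
    filter_upwards [hh.continuousOn b hb (hV.mem_nhds hbV)] with s' hs' s τ _ _ h1 h2 _
    exact disjoint_left.1 hUV (hRU _ h1 h2) hs'

/-- Two arrival times at `x` differing by less than the minimal return time `δ` must be equal, since
otherwise one starting point would flow to the other too soon. So `⌊τ / δ⌋` determines the starting
point. -/
theorem finite_flow_to {h : ℝ → X} {ℓ : ℝ} (hh : S.IsStraight 1 h (Icc 0 ℓ))
    (hinj : InjOn h (Ioo 0 ℓ)) {v : ℂ} (hv : v.im ≠ 0) (x : X) (T : ℝ) :
    {s ∈ Ioo 0 ℓ | ∃ τ ∈ Icc 0 T, S.Flow v τ (h s) x}.Finite := by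
  obtain ⟨δ, hδ, H⟩ := exists_min_return isCompact_Icc hh hv
  choose! τ hτ hfl using fun (s : ℝ) (hs : ∃ τ ∈ Icc 0 T, S.Flow v τ (h s) x) => hs
  have key : ∀ s ∈ Ioo 0 ℓ, ∀ s' ∈ Ioo 0 ℓ, S.Flow v (τ s) (h s) x → S.Flow v (τ s') (h s') x →
      ⌊τ s / δ⌋ = ⌊τ s' / δ⌋ → τ s ≤ τ s' := by
    intro s hs s' hs' h1 h2 h3
    by_contra! hlt
    refine H s (Ioo_subset_Icc_self hs) s' (Ioo_subset_Icc_self hs') (τ s - τ s')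
      ⟨by linarith, ?_⟩ (h1.flow_sub h2)
    have := Int.abs_sub_lt_one_of_floor_eq_floor h3
    rw [← sub_div, abs_of_pos (by apply div_pos <;> linarith), div_lt_one hδ] at this
    exact this
  refine Finite.of_injOn (f := fun s => ⌊τ s / δ⌋) (t := Icc 0 ⌊T / δ⌋) ?_ ?_ (finite_Icc _ _)
  · rintro s ⟨hs, hs'⟩
    have := hτ s hs'
    refine ⟨Int.floor_nonneg.2 (div_nonneg this.1 hδ.le), Int.floor_le_floor ?_⟩
    have := this.2
    gcongr
  · rintro s ⟨hs, hs1⟩ s' ⟨hs', hs1'⟩ heq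
    have h1 := hfl s hs1
    have h2 := hfl s' hs1'
    have h3 : τ s = τ s' := le_antisymm (key s hs s' hs' h1 h2 heq)
      (key s' hs' s hs h2 h1 heq.symm)
    have h4 := h1.flow_sub h2
    rw [h3, sub_self] at h4
    exact hinj hs hs' (flow_zero_iff h4)

variable [CompactSpace X]

/-- Only finitely many points of a horizontal segment fall into a singularity before a
given time. -/
theorem finite_falls {h : ℝ → X} {ℓ : ℝ} (hh : S.IsStraight 1 h (Icc 0 ℓ))
    (hinj : InjOn h (Ioo 0 ℓ)) {v : ℂ} (hv : v.im ≠ 0) (T : ℝ) :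
    {s ∈ Ioo 0 ℓ | ∃ t ≤ T, S.Falls v t (h s)}.Finite := by
  obtain ⟨η, hη, Ξ, hΞ, H⟩ := exists_gates (v := v)
    (isCompact_Icc.image_of_continuousOn hh.continuousOn).isClosed (disjoint_image_sing hh)
  refine (hΞ.biUnion fun x _ => finite_flow_to hh hinj hv x T).subset ?_
  rintro s ⟨hs, t, htT, ht⟩
  obtain ⟨h1, x, hx, h2⟩ := H _ (mem_image_of_mem h (Ioo_subset_Icc_self hs)) t ht
  exact mem_biUnion hx ⟨hs, t - η, ⟨by linarith, by linarith⟩, h2⟩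

/-- Each gate serves at most one break point: if two break points passed the same gate, the one
taking longer would flow through the other and so meet the segment again. -/
theorem finite_breaks {h : ℝ → X} {ℓ : ℝ} (hh : S.IsStraight 1 h (Icc 0 ℓ))
    (hinj : InjOn h (Ioo 0 ℓ)) (v : ℂ) : (S.breaks ℓ h v).Finite := by
  obtain ⟨η, hη, Ξ, hΞ, H⟩ := exists_gates (v := v)
    (isCompact_Icc.image_of_continuousOn hh.continuousOn).isClosed (disjoint_image_sing hh)
  refine (hΞ.biUnion (t := fun x => {s ∈ S.breaks ℓ h v | ∃ τ, S.Flow v τ (h s) x})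
    fun x _ => Set.Subsingleton.finite ?_).subset ?_
  · have key : ∀ s ∈ S.breaks ℓ h v, ∀ s' ∈ Ioo 0 ℓ, ∀ τ τ', S.Flow v τ (h s) x →
        S.Flow v τ' (h s') x → τ ≤ τ' := by
      intro s hs s' hs' τ τ' h1 h2
      by_contra! hlt
      exact hs.2.2 _ (sub_pos.2 hlt) _ (h1.flow_sub h2) (mem_image_of_mem h hs')
    rintro s ⟨hs, τ, h1⟩ s' ⟨hs', τ', h2⟩
    have h3 := le_antisymm (key s hs s' hs'.1 τ τ' h1 h2) (key s' hs' s hs.1 τ' τ h2 h1)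
    have h4 := h1.flow_sub h2
    rw [h3, sub_self] at h4
    exact hinj hs.1 hs'.1 (flow_zero_iff h4)
  · rintro s hs
    obtain ⟨t, ht⟩ := mem_critical_iff.1 hs.2.1
    obtain ⟨h1, x, hx, h2⟩ := H _ (mem_image_of_mem h (Ioo_subset_Icc_self hs.1)) t ht
    exact mem_biUnion hx ⟨hs, _, h2⟩

omit [CompactSpace X] in
theorem Falls.unique {v : ℂ} {t t' : ℝ} {p : X} (h : S.Falls v t p) (h' : S.Falls v t' p) :
    t = t' := by
  obtain ⟨b, h⟩ := h
  obtain ⟨b', h'⟩ := h'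
  rcases lt_trichotomy t t' with hlt | rfl | hlt
  · exact absurd (h'.2.2.1 ⟨h.1.le, hlt⟩) h.notMem_dom
  · rfl
  · exact absurd (h.2.2.1 ⟨h'.1.le, hlt⟩) h'.notMem_dom

theorem exists_bound_falls_breaks {h : ℝ → X} {ℓ : ℝ} (hh : S.IsStraight 1 h (Icc 0 ℓ))
    (hinj : InjOn h (Ioo 0 ℓ)) (v : ℂ) :
    ∃ C, ∀ s ∈ S.breaks ℓ h v, ∀ t, S.Falls v t (h s) → t ≤ C := by
  choose! τ hτ using fun (s : ℝ) (hs : s ∈ S.breaks ℓ h v) => mem_critical_iff.1 hs.2.1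
  obtain ⟨C, hC⟩ := ((finite_breaks hh hinj v).image τ).bddAbove
  exact ⟨C, fun s hs t ht => by
    rw [ht.unique (hτ s hs)]
    exact hC (mem_image_of_mem τ hs)⟩

end

/-! ### Strips over horizontal segments -/

section

variable {X : Type*} [TopologicalSpace X] {S : TranslationSurface X}

theorem tendsto_strip_displacement (v : ℂ) (D : Set (ℝ × ℝ)) (s y : ℝ) :
    Tendsto (fun u : ℝ × ℝ => ((u.1 - s : ℝ) : ℂ) + ((u.2 - y : ℝ) : ℂ) * v) (𝓝[D] (s, y))
      (𝓝 0) := by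
  have : Continuous (fun u : ℝ × ℝ => ((u.1 - s : ℝ) : ℂ) + ((u.2 - y : ℝ) : ℂ) * v) := by
    fun_prop
  simpa using (this.tendsto (s, y)).mono_left nhdsWithin_le_nhds

theorem tendsto_fst_displacement (N : Set ℝ) (s : ℝ) :
    Tendsto (fun r : ℝ => ((r - s : ℝ) : ℂ)) (𝓝[N] s) (𝓝 0) := by
  simpa using tendsto_displacement 1 N s

theorem tendsto_fst_nhdsWithin_prod {N Y : Set ℝ} {s y : ℝ} :
    Tendsto Prod.fst (𝓝[N ×ˢ Y] (s, y)) (𝓝[N] s) := by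
  rw [nhdsWithin_prod_eq]; exact tendsto_fst

theorem tendsto_snd_nhdsWithin_prod {N Y : Set ℝ} {s y : ℝ} :
    Tendsto Prod.snd (𝓝[N ×ˢ Y] (s, y)) (𝓝[Y] y) := by
  rw [nhdsWithin_prod_eq]; exact tendsto_snd

variable [T2Space X]

/-- When the heights `y₁` and `y₂` are joined within one coordinate disc, the horizontal slice at
`y₁` and the straightness of trajectories determine the map near `(s, y₂)`. -/
theorem locDev_strip_of_slice {h : ℝ → X} {v : ℂ} {N Y : Set ℝ} (hY : Y.OrdConnected)
    (hdom : ∀ s ∈ N, Y ⊆ S.dom v (h s)) {s : ℝ} (hs : s ∈ N) {x : X}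
    {ζ : OpenPartialHomeomorph X ℂ} (hζ : S.IsCoord x 1 ζ) {R : ℝ} (hR : 0 < R)
    (hball : Metric.closedBall 0 R ⊆ ζ.target) {y₁ y₂ : ℝ} (hy₁ : y₁ ∈ Y) (hy₂ : y₂ ∈ Y)
    (hsrc : S.fl v (h s) y₁ ∈ ζ.source)
    (hlt : ‖ζ (S.fl v (h s) y₁)‖ + |y₂ - y₁| * ‖v‖ < R)
    (hsl : S.LocDev (𝓝[N] s) (fun r => S.fl v (h r) y₁) (fun r => ((r - s : ℝ) : ℂ))
      (S.fl v (h s) y₁)) :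
    S.LocDev (𝓝[N ×ˢ Y] (s, y₂)) (fun u => S.fl v (h u.1) u.2)
      (fun u => ((u.1 - s : ℝ) : ℂ) + ((u.2 - y₂ : ℝ) : ℂ) * v) (S.fl v (h s) y₂) := by
  have hstr : ∀ r ∈ N, S.IsStraight v (S.fl v (h r)) Y :=
    fun r hr => (isStraight_fl v (h r)).mono (hdom r hr)
  have h2 := (hstr s hs).stay hY hζ hR hball hy₁ hy₂ hsrc (by simpa using hlt)
  refine LocDev.of_coord hζ h2.1 (flow_fl (hdom s hs hy₂)).end_notMem
    (tendsto_strip_displacement _ _ _ _) ?_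
  have hcont : Tendsto (fun u : ℝ × ℝ => ‖ζ (S.fl v (h s) y₁) + ((u.1 - s : ℝ) : ℂ)‖ +
      |u.2 - y₁| * ‖v‖) (𝓝[N ×ˢ Y] (s, y₂))
      (𝓝 (‖ζ (S.fl v (h s) y₁) + ((s - s : ℝ) : ℂ)‖ + |y₂ - y₁| * ‖v‖)) := by
    have : Continuous (fun u : ℝ × ℝ => ‖ζ (S.fl v (h s) y₁) + ((u.1 - s : ℝ) : ℂ)‖ +
      |u.2 - y₁| * ‖v‖) := by fun_prop
    exact (this.tendsto (s, y₂)).mono_left nhdsWithin_le_nhds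
  have hev := hcont.eventually (gt_mem_nhds (by simpa using hlt))
  have hcoord := (tendsto_fst_nhdsWithin_prod (N := N) (Y := Y) (s := s) (y := y₂)).eventually
    (hsl.coord (tendsto_fst_displacement N s) hζ hsrc)
  filter_upwards [hev, hcoord, self_mem_nhdsWithin] with u hu1 hu2 hu3
  have e1 : ζ (S.fl v (h u.1) y₁) = ζ (S.fl v (h s) y₁) + ((u.1 - s : ℝ) : ℂ) := by
    rw [← hu2.2]; ring
  have h3 := (hstr u.1 hu3.1).stay hY hζ hR hball hy₁ hu3.2 hu2.1
    (by rw [e1, pow_one, pow_one]; exact hu1)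
  refine ⟨h3.1, ?_⟩
  have e2 := h3.2.2
  have e3 := h2.2.2
  rw [pow_one, pow_one] at e2 e3
  rw [e2, e3, e1]
  push_cast
  ring

/-- Flowing a horizontal segment gives a local isometry from the part of the plane where it
is defined. -/
theorem locDev_strip {h : ℝ → X} {J : Set ℝ} (hh : S.IsStraight 1 h J) {v : ℂ} {N Y : Set ℝ}
    (hN : N ⊆ J) (hY : Y.OrdConnected) (h0 : 0 ∈ Y) (hdom : ∀ s ∈ N, Y ⊆ S.dom v (h s))
    {s y : ℝ} (hs : s ∈ N) (hy : y ∈ Y) :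
    S.LocDev (𝓝[N ×ˢ Y] (s, y)) (fun u => S.fl v (h u.1) u.2)
      (fun u => ((u.1 - s : ℝ) : ℂ) + ((u.2 - y : ℝ) : ℂ) * v) (S.fl v (h s) y) := by
  have hreg : ∀ y ∈ Y, S.fl v (h s) y ∉ S.sing := fun y hy => (flow_fl (hdom s hs hy)).end_notMem
  have hstr : S.IsStraight v (S.fl v (h s)) Y := (isStraight_fl v (h s)).mono (hdom s hs)
  have slice_of : ∀ {y}, S.LocDev (𝓝[N ×ˢ Y] (s, y)) (fun u => S.fl v (h u.1) u.2)
      (fun u => ((u.1 - s : ℝ) : ℂ) + ((u.2 - y : ℝ) : ℂ) * v) (S.fl v (h s) y) → y ∈ Y →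
      S.LocDev (𝓝[N] s) (fun r => S.fl v (h r) y) (fun r => ((r - s : ℝ) : ℂ))
        (S.fl v (h s) y) := by
    intro y H hy
    refine (H.comp (k := fun r => (r, y)) (l' := 𝓝[N] s) ?_).congr .rfl
      (Eventually.of_forall fun r => by simp)
    rw [nhdsWithin_prod_eq]
    exact tendsto_id.prodMk (tendsto_const_nhdsWithin hy)
  -- Whether the slice at height `y` is an isometry near `s` is locally constant in `y`, by passing
  -- up and down within a disc; it holds at height `0`.
  have hslice : S.LocDev (𝓝[N] s) (fun r => S.fl v (h r) y) (fun r => ((r - s : ℝ) : ℂ))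
        (S.fl v (h s) y) := by
    refine forall_of_locally_constant hY.isPreconnected
      (G := fun y => S.LocDev (𝓝[N] s) (fun r => S.fl v (h r) y) (fun r => ((r - s : ℝ) : ℂ))
        (S.fl v (h s) y)) ?_ h0 hy ?_
    · intro y₀ hy₀
      obtain ⟨ζ, hζ⟩ := S.exists_isCoord_one (hreg y₀ hy₀)
      obtain ⟨R, hR, -, hball⟩ := hζ.exists_closedBall one_pos
      have hev : ∀ᶠ y in 𝓝[Y] y₀, |y - y₀| * ‖v‖ < R / 2 := by
        have : Continuous (fun y : ℝ => |y - y₀| * ‖v‖) := by fun_prop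
        refine mem_nhdsWithin_of_mem_nhds (this.continuousAt.eventually (gt_mem_nhds ?_))
        simpa using hR
      filter_upwards [hev, self_mem_nhdsWithin] with y₁ hy1 hy1Y
      have h2 := hstr.stay hY hζ hR hball hy₀ hy1Y hζ.mem
        (by rw [hζ.map_self, pow_one, pow_one, norm_zero]; linarith)
      have e2 := h2.2.2
      rw [hζ.map_self, pow_one, pow_one, zero_add] at e2
      constructor
      · intro H
        refine slice_of (locDev_strip_of_slice hY hdom hs hζ hR hball hy₀ hy1Y hζ.mem ?_ H) hy1Y
        rw [hζ.map_self, norm_zero]; linarith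
      · intro H
        refine slice_of (locDev_strip_of_slice hY hdom hs hζ hR hball hy1Y hy₀ h2.1 ?_ H) hy₀
        rw [e2, norm_mul, Complex.norm_real, Real.norm_eq_abs, abs_sub_comm y₀]
        linarith
    · rw [fl_zero (hh s (hN hs)).1]
      refine ((hh.locDev (hN hs)).mono (nhdsWithin_mono s hN)).congr ?_
        (Eventually.of_forall fun r => by simp)
      filter_upwards [self_mem_nhdsWithin] with r hr
      exact (fl_zero (hh r (hN hr)).1).symm
  obtain ⟨ζ, hζ⟩ := S.exists_isCoord_one (hreg y hy)
  obtain ⟨R, hR, -, hball⟩ := hζ.exists_closedBall one_pos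
  exact locDev_strip_of_slice hY hdom hs hζ hR hball hy hy hζ.mem
    (by simpa [hζ.map_self] using hR) hslice

/-- Straight lines in a strip flowed from a horizontal segment. -/
theorem isStraight_strip {h : ℝ → X} {J : Set ℝ} (hh : S.IsStraight 1 h J) {v : ℂ} {N Y : Set ℝ}
    (hN : N ⊆ J) (hY : Y.OrdConnected) (h0 : 0 ∈ Y) (hdom : ∀ s ∈ N, Y ⊆ S.dom v (h s))
    (s y a b : ℝ) {I : Set ℝ} (hI : ∀ t ∈ I, s + t * a ∈ N ∧ y + t * b ∈ Y) :
    S.IsStraight (a + b * v) (fun t => S.fl v (h (s + t * a)) (y + t * b)) I := by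
  intro t ht
  have H := locDev_strip hh hN hY h0 hdom (hI t ht).1 (hI t ht).2
  refine (H.comp (k := fun r => (s + r * a, y + r * b)) (l' := 𝓝[I] t) ?_).congr .rfl
    (Eventually.of_forall fun r => ?_)
  · refine tendsto_nhdsWithin_iff.2 ⟨?_, ?_⟩
    · have : Continuous (fun r : ℝ => (s + r * a, y + r * b)) := by fun_prop
      exact (this.tendsto t).mono_left nhdsWithin_le_nhds
    · filter_upwards [self_mem_nhdsWithin] with r hr
      exact hI r hr
  · simp only [Function.comp]
    push_cast
    ring

end

/-! ### Existence of a return -/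

section

variable {X : Type*} [TopologicalSpace X] {S : TranslationSurface X} [T2Space X] [CompactSpace X]

omit [T2Space X] [CompactSpace X] in
theorem notMem_critical_of_neverMeets {h : ℝ → X} {ℓ : ℝ} {v : ℂ} {s : ℝ} (hs : s ∈ Ioo 0 ℓ)
    (hb : s ∉ S.breaks ℓ h v) (hn : S.NeverMeets v (h s) (h '' Ioo 0 ℓ)) :
    h s ∉ S.critical v := fun hc => hb ⟨hs, hc, hn⟩

/-- A horizontal interval without break points contains a point whose trajectory returns. -/
theorem exists_return {h : ℝ → X} {ℓ : ℝ} (hh : S.IsStraight 1 h (Icc 0 ℓ)) {v : ℂ}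
    (hv : v.re = 0) (hv' : v.im * v.im = 1) {a b : ℝ} (hab : a < b)
    (hsub : Ioo a b ⊆ Ioo 0 ℓ) (hnb : ∀ s ∈ Ioo a b, s ∉ S.breaks ℓ h v) :
    ∃ s ∈ Ioo a b, ∃ t > 0, ∃ s' ∈ Ioo 0 ℓ, S.Flow v t (h s) (h s') := by
  by_contra! hcon
  have hdom : ∀ s ∈ Ioo a b, Ici 0 ⊆ S.dom v (h s) := by
    intro s hs t ht
    refine (mem_dom_or_falls (hh s (Ioo_subset_Icc_self (hsub hs))).1 ht).resolve_right ?_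
    rintro ⟨T, -, hT⟩
    refine notMem_critical_of_neverMeets (hsub hs) (hnb s hs) ?_ (mem_critical_iff.2 ⟨T, hT⟩)
    rintro t ht q hq ⟨s', hs', rfl⟩
    exact hcon s hs t ht s' hs' hq
  -- If two trajectories met after unequal times, the earlier start would flow into the later one,
  -- which is a return.
  have hinj : ∀ s ∈ Ioo a b, ∀ s' ∈ Ioo a b, ∀ t ≥ 0, ∀ t' ≥ 0,
      S.fl v (h s) t = S.fl v (h s') t' → t ≤ t' := by
    intro s hs s' hs' t ht t' ht' heq
    by_contra! hlt
    have h1 := flow_fl (hdom s hs ht)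
    have h2 := flow_fl (hdom s' hs' ht')
    rw [← heq] at h2
    exact hcon s hs _ (sub_pos.2 hlt) s' (hsub hs') (h1.flow_sub h2)
  set s₀ := (a + b) / 2 with hs₀
  set r := (b - a) / 2 with hr
  have hrpos : 0 < r := by rw [hr]; linarith
  have hs₀m : s₀ ∈ Ioo a b := ⟨by rw [hs₀]; linarith, by rw [hs₀]; linarith⟩
  set p : ℕ → X := fun k => S.fl v (h s₀) (r + k) with hp
  have hvim : |v.im| = 1 := by
    have : |v.im| * |v.im| = 1 := by rw [← abs_mul, hv', abs_one]
    nlinarith [abs_nonneg v.im]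
  have hmem : ∀ (k : ℕ) (w : ℂ), ‖w‖ < r → ∀ t ∈ Icc (0 : ℝ) 1,
      s₀ + t * w.re ∈ Ioo a b ∧ r + k + t * (w.im * v.im) ∈ Ici (0 : ℝ) := by
    intro k w hw t ht
    have h1 : |t * w.re| < r := by
      rw [abs_mul, abs_of_nonneg ht.1]
      have := Complex.abs_re_le_norm w
      nlinarith [ht.2, abs_nonneg w.re]
    have h2 : |t * (w.im * v.im)| < r := by
      rw [abs_mul, abs_mul, hvim, mul_one, abs_of_nonneg ht.1]
      have := Complex.abs_im_le_norm w
      nlinarith [ht.2, abs_nonneg w.im]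
    have h4 := abs_lt.1 h1
    have h5 := abs_lt.1 h2
    have hk : (0 : ℝ) ≤ k := k.cast_nonneg
    rw [hr] at h4
    exact ⟨⟨by linarith [h4.1], by linarith [h4.2]⟩, by rw [mem_Ici]; linarith [h5.1]⟩
  have hcurve : ∀ (k : ℕ) (w : ℂ), ‖w‖ < r →
      S.IsStraight w (fun t => S.fl v (h (s₀ + t * w.re)) (r + k + t * (w.im * v.im)))
        (Icc 0 1) := by
    intro k w hw
    -- As `v = ±i`, the factor `v.im` corrects the sign: any direction `w` is available in the
    -- strip, so every `p k` is the centre of a disc of radius `r`.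
    have hwv : (w.re : ℂ) + ((w.im * v.im : ℝ) : ℂ) * v = w := by
      apply Complex.ext
      · simp [hv]
      · simp [mul_assoc, hv']
    have := isStraight_strip hh (hsub.trans Ioo_subset_Icc_self) ordConnected_Ici
      self_mem_Ici hdom s₀ (r + k) w.re (w.im * v.im) (hmem k w hw)
    rwa [hwv] at this
  obtain ⟨x, hx⟩ := exists_clusterPt_of_compactSpace (map p atTop)
  obtain ⟨m, ζ, hζ⟩ := S.exists_isCoord x
  obtain ⟨R, hR, -, hball⟩ := hζ.exists_closedBall one_pos
  -- Displacements shorter than `2 ρ` must stay in the coordinate about `x` when started with `‖ζ‖ ^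
  -- m < ρ`, stay in the disc of radius `r`, and change the height by less than `1`.
  set ρ := min (R ^ m) (min r 1) / 3 with hρ
  have hρpos : 0 < ρ := by positivity
  have hρ1 : 3 * ρ ≤ R ^ m := by
    rw [hρ]; linarith [min_le_left (R ^ m) (min r 1)]
  have hρ2 : 3 * ρ ≤ r := by
    rw [hρ]; linarith [min_le_right (R ^ m) (min r 1), min_le_left r 1]
  have hρ3 : 3 * ρ ≤ 1 := by
    rw [hρ]; linarith [min_le_right (R ^ m) (min r 1), min_le_right r 1]
  have hfreq := (mapClusterPt_iff_frequently.1 hx) _ (hζ.eventually_norm_lt hρpos)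
  have hend : ∀ (k : ℕ) (w : ℂ), ‖w‖ < 2 * ρ → p k ∈ ζ.source → ‖ζ (p k)‖ ^ m < ρ →
      S.fl v (h (s₀ + w.re)) (r + k + w.im * v.im) ∉ S.sing ∧
      S.fl v (h (s₀ + w.re)) (r + k + w.im * v.im) ∈ ζ.source ∧
      ζ (S.fl v (h (s₀ + w.re)) (r + k + w.im * v.im)) ^ m = ζ (p k) ^ m + w ∧
      s₀ + w.re ∈ Ioo a b ∧ 0 ≤ r + k + w.im * v.im := by
    intro k w hw hk1 hk2
    have hwr : ‖w‖ < r := by linarith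
    have h1 := hcurve k w hwr
    have h2 := hmem k w hwr 1 (by simp)
    have h3 := h1.stay ordConnected_Icc hζ hR hball (t₀ := 0) (t := 1) (by simp) (by simp)
      (by simpa [hp] using hk1) (by
        simp only [zero_mul, add_zero, sub_zero, abs_one, one_mul]
        exact lt_of_lt_of_le (add_lt_add hk2 hw) (by linarith))
    have h4 := (h1 1 (by simp)).1
    simp only [one_mul, zero_mul, add_zero, sub_zero, Complex.ofReal_one, mem_Ici] at h2 h3 h4
    exact ⟨h4, h3.1, h3.2.2, h2⟩
  obtain ⟨k, -, hk1, hk2⟩ := (Filter.frequently_atTop.1 hfreq) 0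
  -- A singular `x` would lie inside the disc about `p k`, which is free of singularities. For a
  -- regular `x`, the disc about `p k` contains a later `p l`, although `l ≥ k + 1` and heights in
  -- the disc region used are less than `r + k + 1`.
  by_cases hxs : x ∈ S.sing
  · have hw : ‖-ζ (p k) ^ m‖ < 2 * ρ := by
      rw [norm_neg, norm_pow]; linarith
    obtain ⟨h1, h2, h3, -⟩ := hend k _ hw hk1 hk2
    rw [add_neg_cancel] at h3
    have h4 := eq_zero_of_pow_eq_zero h3
    rw [← hζ.map_self] at h4
    exact h1 (ζ.injOn h2 hζ.mem h4 ▸ hxs)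
  · obtain rfl := hζ.eq_one hxs
    obtain ⟨l, hl, hl1, hl2⟩ := (Filter.frequently_atTop.1 hfreq) (k + 1)
    rw [pow_one] at hk2 hl2
    have hw : ‖ζ (p l) - ζ (p k)‖ < 2 * ρ := (norm_sub_le _ _).trans_lt (by linarith)
    obtain ⟨h1, h2, h3, h4, h5⟩ := hend k _ hw hk1 (by rwa [pow_one])
    rw [pow_one, pow_one, add_sub_cancel] at h3
    have h6 := ζ.injOn h2 hl1 h3
    have h7 := hinj _ hs₀m _ h4 (r + l) (by positivity) _ h5 h6.symm
    have h8 : |(ζ (p l) - ζ (p k)).im * v.im| < 1 := by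
      rw [abs_mul, hvim, mul_one]
      exact (Complex.abs_im_le_norm _).trans_lt (by linarith)
    have h9 : (k : ℝ) + 1 ≤ l := by exact_mod_cast hl
    have := (abs_lt.1 h8).2
    linarith

end

/-! ### Boundedness of the return times -/

section

variable {X : Type*} [TopologicalSpace X] {S : TranslationSurface X}

variable (S) in
/-- The trajectory of `h s` meets the segment again no later than at time `T`. -/
def ReturnsBy (ℓ : ℝ) (h : ℝ → X) (v : ℂ) (T s : ℝ) : Prop :=
  ∃ t ∈ Ioc 0 T, ∃ s' ∈ Ioo 0 ℓ, S.Flow v t (h s) (h s')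

/-- An endpoint is critical in direction `v` or in direction `-v`, and well-cutness applies to that
direction. This puts both flow directions on the same footing. -/
theorem IsWellCut.endpoint {ℓ : ℝ} {h : ℝ → X} (hw : S.IsWellCut ℓ h) {v : ℂ}
    (hv : v = Complex.I ∨ v = -Complex.I) {e : ℝ} (he : e ∈ ({0, ℓ} : Set ℝ)) :
    (h e ∈ S.critical v ∧ S.NeverMeets v (h e) (h '' Ioo 0 ℓ)) ∨
      S.NeverMeets (-v) (h e) (h '' Ioo 0 ℓ) := by
  have hcrit : h e ∈ S.criticalLeaves := by
    rcases he with rfl | he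
    · exact hw.left_mem
    · rw [mem_singleton_iff.1 he]; exact hw.right_mem
  have hf := hw.forward e he
  have hb := hw.backward e he
  rcases hv with rfl | rfl
  · exact hcrit.imp (fun hc => ⟨hc, hf hc⟩) hb
  · rw [neg_neg]
    exact hcrit.symm.imp (fun hc => ⟨hc, hb hc⟩) hf

variable [T2Space X]

theorem Flow.falls {v : ℂ} {t T : ℝ} {p q : X} (h : S.Flow v t p q) (hf : S.Falls v T q)
    (ht : 0 ≤ t) : S.Falls v (t + T) p := by
  obtain ⟨b, hT, hb, hdom, hlim⟩ := hf
  have hfl : ∀ r ∈ S.dom v q, S.Flow v (t + r) p (S.fl v q r) := fun r hr => h.trans (flow_fl hr)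
  refine ⟨b, by linarith, hb, fun r hr => ?_, ?_⟩
  · rcases le_total r t with hrt | hrt
    · exact h.exists_of_mem (by rw [uIcc_of_le ht]; exact ⟨hr.1, hrt⟩)
    · have := hfl (r - t) (hdom ⟨by linarith, by linarith [hr.2]⟩)
      rw [add_sub_cancel] at this
      exact ⟨_, this⟩
  · have hmap : Tendsto (fun r => r - t) (𝓝[<] (t + T)) (𝓝[<] T) := by
      refine tendsto_nhdsWithin_iff.2 ⟨?_, ?_⟩
      · have : Continuous (fun r : ℝ => r - t) := by fun_prop
        simpa using (this.tendsto (t + T)).mono_left nhdsWithin_le_nhds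
      · filter_upwards [self_mem_nhdsWithin] with r hr
        rw [mem_Iio] at hr ⊢
        linarith
    refine (hlim.comp hmap).congr' ?_
    filter_upwards [hmap.eventually (Ico_mem_nhdsLT hT)] with r hr
    have := hfl (r - t) (hdom hr)
    rw [add_sub_cancel] at this
    exact this.fl_eq.symm

theorem Falls.lt_of_flow {v : ℂ} {t T : ℝ} {p q : X} (hf : S.Falls v T p)
    (h : S.Flow v t p q) : t < T := by
  obtain ⟨b, hb⟩ := hf
  exact hb.lt_of_mem_dom ⟨q, h⟩

theorem Falls.of_flow {v : ℂ} {t T : ℝ} {p q : X} (hf : S.Falls v T p)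
    (h : S.Flow v t p q) : S.Falls v (T - t) q := by
  have htT := hf.lt_of_flow h
  obtain ⟨b, hb⟩ := hf
  have hfl : ∀ r ∈ S.dom v p, S.Flow v (r - t) q (S.fl v p r) := fun r hr => by
    simpa [sub_eq_neg_add] using h.symm.trans (flow_fl hr)
  have hd : ∀ r ∈ Ico 0 T, r ∈ S.dom v p := hb.2.2.1
  -- The time `t` may be negative; times between `t` and `0` are then covered by the trajectory to
  -- `q`.
  have hd' : ∀ r ∈ Ico t T, r ∈ S.dom v p := fun r hr => by
    rcases le_total 0 r with h0 | h0
    · exact hd r ⟨h0, hr.2⟩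
    · exact (ordConnected_dom v p).out ⟨q, h⟩ (zero_mem_dom h.start_notMem) ⟨hr.1, h0⟩
  refine ⟨b, by linarith, hb.2.1, fun r hr => ?_, ?_⟩
  · have := hfl (r + t) (hd' _ ⟨by linarith [hr.1], by linarith [hr.2]⟩)
    rw [add_sub_cancel_right] at this
    exact ⟨_, this⟩
  · have hmap : Tendsto (fun r => r + t) (𝓝[<] (T - t)) (𝓝[<] T) := by
      refine tendsto_nhdsWithin_iff.2 ⟨?_, ?_⟩
      · have : Continuous (fun r : ℝ => r + t) := by fun_prop
        simpa using (this.tendsto (T - t)).mono_left nhdsWithin_le_nhds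
      · filter_upwards [self_mem_nhdsWithin] with r hr
        rw [mem_Iio] at hr ⊢
        linarith
    refine (hb.2.2.2.comp hmap).congr' ?_
    filter_upwards [hmap.eventually (Ico_mem_nhdsLT htT)] with r hr
    have := hfl (r + t) (hd' _ hr)
    rw [add_sub_cancel_right] at this
    exact this.fl_eq.symm

variable [CompactSpace X]

/-- Only finitely many points of the segment fall by time `T`, and `s` is not one of them. -/
theorem exists_nhds_dom {h : ℝ → X} {ℓ : ℝ} (hh : S.IsStraight 1 h (Icc 0 ℓ))
    (hinj : InjOn h (Ioo 0 ℓ)) {v : ℂ} (hv : v.im ≠ 0) {s T : ℝ} (hs : s ∈ Ioo 0 ℓ)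
    (hT : T ∈ S.dom v (h s)) :
    ∃ N ∈ 𝓝 s, N ⊆ Ioo 0 ℓ ∧ ∀ r ∈ N, Icc 0 T ⊆ S.dom v (h r) := by
  have hfin := finite_falls hh hinj hv T
  refine ⟨Ioo 0 ℓ ∩ {s ∈ Ioo 0 ℓ | ∃ t ≤ T, S.Falls v t (h s)}ᶜ,
    inter_mem (Ioo_mem_nhds hs.1 hs.2) (hfin.isClosed.isOpen_compl.mem_nhds ?_),
    inter_subset_left, ?_⟩
  · rintro ⟨-, t, ht, b, hb⟩
    exact absurd (hb.lt_of_mem_dom hT) (not_lt.2 ht)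
  · intro r hr t ht
    refine (mem_dom_or_falls (hh r (Ioo_subset_Icc_self hr.1)).1 ht.1).resolve_right ?_
    rintro ⟨T', hT', hf⟩
    exact hr.2 ⟨hr.1, T', hT'.trans ht.2, hf⟩

/-- The flow is horizontally an isometry near `s`, so the point at parameter `r` arrives at
parameter `x + (r - s)`, still in the open segment, after the same time. -/
theorem ReturnsBy.eventually {h : ℝ → X} {ℓ : ℝ} (hh : S.IsStraight 1 h (Icc 0 ℓ))
    (hinj : InjOn h (Ioo 0 ℓ)) {v : ℂ} (hv : v.im ≠ 0) {s T : ℝ} (hs : s ∈ Ioo 0 ℓ)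
    (hr : S.ReturnsBy ℓ h v T s) : ∀ᶠ s' in 𝓝 s, S.ReturnsBy ℓ h v T s' := by
  obtain ⟨t, ht, x, hx, hfl⟩ := hr
  obtain ⟨N, hN, hNs, hdom⟩ := exists_nhds_dom hh hinj hv hs ⟨_, hfl⟩
  have h1 := locDev_strip hh (hNs.trans Ioo_subset_Icc_self) ordConnected_Icc
    (left_mem_Icc.2 ht.1.le) hdom (mem_of_mem_nhds hN) (right_mem_Icc.2 ht.1.le)
  rw [hfl.fl_eq] at h1
  have h2 : S.LocDev (𝓝 s) (fun r => S.fl v (h r) t) (fun r => ((r - s : ℝ) : ℂ)) (h x) := by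
    refine (h1.comp (k := fun r => (r, t)) (l' := 𝓝 s) ?_).congr .rfl
      (Eventually.of_forall fun r => by simp)
    rw [nhdsWithin_prod_eq, nhdsWithin_eq_nhds.2 hN]
    exact tendsto_id.prodMk (tendsto_const_nhdsWithin (right_mem_Icc.2 ht.1.le))
  have hmap : Tendsto (fun r => x + (r - s)) (𝓝 s) (𝓝 x) := by
    have : Continuous (fun r : ℝ => x + (r - s)) := by fun_prop
    simpa using this.tendsto s
  have h3 : S.LocDev (𝓝 s) (fun r => h (x + (r - s))) (fun r => ((r - s : ℝ) : ℂ)) (h x) := by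
    have h4 := hh.locDev (Ioo_subset_Icc_self hx)
    rw [nhdsWithin_eq_nhds.2 (Icc_mem_nhds hx.1 hx.2)] at h4
    exact (h4.comp hmap).congr .rfl (Eventually.of_forall fun r => by simp)
  filter_upwards [h2.eventuallyEq h3, hmap.eventually (Ioo_mem_nhds hx.1 hx.2), hN]
    with r hr1 hr2 hr3
  refine ⟨t, ht, _, hr2, ?_⟩
  rw [← hr1]
  exact flow_fl (hdom r hr3 (right_mem_Icc.2 ht.1.le))

/-- By compactness it suffices that the trajectory of `s` avoids the closed segment during `[δ, T]`.
It cannot hit an endpoint: one that falls without meeting the segment would make `s` a break point,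
and one whose reverse trajectory never meets the segment could not have come from `s`. -/
theorem IsWellCut.eventually_not_returnsBy {ℓ : ℝ} {h : ℝ → X} (hw : S.IsWellCut ℓ h) {v : ℂ}
    (hv : v = Complex.I ∨ v = -Complex.I) {s T : ℝ} (hT : 0 ≤ T) (hs : s ∈ Ioo 0 ℓ)
    (hb : s ∉ S.breaks ℓ h v) (hr : ¬ S.ReturnsBy ℓ h v T s) :
    ∀ᶠ s' in 𝓝 s, ¬ S.ReturnsBy ℓ h v T s' := by
  have hh := hw.horizontal
  have hvim : v.im ≠ 0 := by rcases hv with rfl | rfl <;> simp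
  obtain ⟨δ, hδ, hmin⟩ := exists_min_return isCompact_Icc hh hvim
  have hTd : T ∈ S.dom v (h s) := by
    refine (mem_dom_or_falls (hh s (Ioo_subset_Icc_self hs)).1 hT).resolve_right ?_
    rintro ⟨T', hT', hf⟩
    refine notMem_critical_of_neverMeets hs hb ?_ (mem_critical_iff.2 ⟨T', hf⟩)
    rintro t ht q hq ⟨s', hs', rfl⟩
    exact hr ⟨t, ⟨ht, (hf.lt_of_flow hq).le.trans hT'⟩, s', hs', hq⟩
  obtain ⟨N, hN, hNs, hdom⟩ := exists_nhds_dom hh hw.injOn hvim hs hTd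
  have hne : ∀ t ∈ Icc δ T, ∀ x ∈ Icc 0 ℓ, S.fl v (h s) t ≠ h x := by
    intro t ht x hx heq
    have ht0 : 0 < t := hδ.trans_le ht.1
    have hfl := flow_fl (hdom s (mem_of_mem_nhds hN) ⟨ht0.le, ht.2⟩)
    rw [heq] at hfl
    by_cases hxo : x ∈ Ioo 0 ℓ
    · exact hr ⟨t, ⟨ht0, ht.2⟩, x, hxo, hfl⟩
    have he : x ∈ ({0, ℓ} : Set ℝ) := by
      rcases hx.1.eq_or_lt with h0 | h0
      · exact Or.inl h0.symm
      · exact Or.inr (hx.2.eq_or_lt.resolve_right fun h1 => hxo ⟨h0, h1⟩)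
    rcases hw.endpoint hv he with ⟨hc, hn⟩ | hn
    · obtain ⟨T', hT'⟩ := mem_critical_iff.1 hc
      refine notMem_critical_of_neverMeets hs hb ?_
        (mem_critical_iff.2 ⟨_, hfl.falls hT' ht0.le⟩)
      rintro t' ht' q hq ⟨s', hs', rfl⟩
      have hlt : T < t' := by
        by_contra! hle
        exact hr ⟨t', ⟨ht', hle⟩, s', hs', hq⟩
      have h1 : S.Flow v (t' - t) (h x) (h s') := by
        simpa [sub_eq_neg_add] using hfl.symm.trans hq
      exact hn _ (by linarith [ht.2]) _ h1 (mem_image_of_mem h hs')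
    · have := hfl.symm.neg
      rw [neg_neg] at this
      exact hn t ht0 _ this (mem_image_of_mem h hs)
  have hev : ∀ᶠ s' in 𝓝 s, ∀ u ∈ Icc δ T ×ˢ Icc 0 ℓ,
      u ∈ Icc δ T ×ˢ Icc 0 ℓ → s' ∈ N → S.fl v (h s') u.1 ≠ h u.2 := by
    refine (isCompact_Icc.prod isCompact_Icc).eventually_forall_of_forall_eventually ?_
    rintro ⟨t, x⟩ ⟨ht, hx⟩
    have ht' : t ∈ Icc 0 T := ⟨hδ.le.trans ht.1, ht.2⟩
    have h1 := (locDev_strip hh (hNs.trans Ioo_subset_Icc_self) ordConnected_Icc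
      (left_mem_Icc.2 hT) hdom (mem_of_mem_nhds hN) ht').tendsto
      (tendsto_strip_displacement v _ s t)
    obtain ⟨U, V, hU, hV, hfU, hhV, hUV⟩ := t2_separation (hne t ht x hx)
    have h2 := eventually_nhdsWithin_iff.1 (h1.eventually (hU.mem_nhds hfU))
    have h3 := eventually_nhdsWithin_iff.1 (hh.continuousOn x hx (hV.mem_nhds hhV))
    have c1 : Tendsto (fun z : ℝ × ℝ × ℝ => (z.1, z.2.1)) (𝓝 (s, t, x)) (𝓝 (s, t)) :=
      Continuous.tendsto (by fun_prop) (s, t, x)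
    have c2 : Tendsto (fun z : ℝ × ℝ × ℝ => z.2.2) (𝓝 (s, t, x)) (𝓝 x) :=
      Continuous.tendsto (by fun_prop) (s, t, x)
    filter_upwards [c1.eventually h2, c2.eventually h3] with z hz1 hz2 hzK hzN heq
    refine disjoint_left.1 hUV (hz1 ⟨hzN, hδ.le.trans hzK.1.1, hzK.1.2⟩) ?_
    rw [heq]
    exact hz2 hzK.2
  filter_upwards [hev, hN] with s' h1 h2
  rintro ⟨t, ht, x, hx, hfl⟩
  have hK : (t, x) ∈ Icc δ T ×ˢ Icc 0 ℓ := by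
    refine ⟨⟨?_, ht.2⟩, Ioo_subset_Icc_self hx⟩
    by_contra! hlt
    exact hmin s' (Ioo_subset_Icc_self (hNs h2)) x (Ioo_subset_Icc_self hx) t ⟨ht.1, hlt⟩ hfl
  exact h1 (t, x) hK hK h2 hfl.fl_eq

/-- The first return times are bounded on an interval without break points. -/
theorem IsWellCut.exists_returnsBy {ℓ : ℝ} {h : ℝ → X} (hw : S.IsWellCut ℓ h) {v : ℂ}
    (hv : v = Complex.I ∨ v = -Complex.I) {a b : ℝ} (hsub : Ioo a b ⊆ Ioo 0 ℓ)
    (hnb : ∀ s ∈ Ioo a b, s ∉ S.breaks ℓ h v) :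
    ∃ T, ∀ s ∈ Ioo a b, S.ReturnsBy ℓ h v T s := by
  rcases le_or_gt b a with hba | hab
  · exact ⟨0, by simp [Ioo_eq_empty (not_lt.2 hba)]⟩
  have hvim : v.im ≠ 0 := by rcases hv with rfl | rfl <;> simp
  obtain ⟨s₀, hs₀, T, hT, s', hs', hfl⟩ := exists_return hw.horizontal (v := v)
    (by rcases hv with rfl | rfl <;> simp) (by rcases hv with rfl | rfl <;> simp) hab hsub hnb
  refine ⟨T, fun s hs => forall_of_locally_constant isPreconnected_Ioo
    (G := S.ReturnsBy ℓ h v T) (fun x hx => ?_) hs₀ hs ⟨T, ⟨hT, le_rfl⟩, s', hs', hfl⟩⟩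
  refine Filter.Eventually.filter_mono nhdsWithin_le_nhds ?_
  by_cases hx' : S.ReturnsBy ℓ h v T x
  · filter_upwards [hx'.eventually hw.horizontal hw.injOn hvim (hsub hx)] with y hy
    exact iff_of_true hx' hy
  · filter_upwards [hw.eventually_not_returnsBy hv hT.le (hsub hx) (hnb x hx) hx'] with y hy
    exact iff_of_false hx' hy

/-- The first return times of a well-cut segment are bounded. -/
theorem IsWellCut.exists_bound_return {ℓ : ℝ} {h : ℝ → X} (hw : S.IsWellCut ℓ h) {v : ℂ}
    (hv : v = Complex.I ∨ v = -Complex.I) :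
    ∃ T, ∀ s ∈ Ioo 0 ℓ, (∃ t > 0, ∃ s' ∈ Ioo 0 ℓ, S.Flow v t (h s) (h s')) →
      S.ReturnsBy ℓ h v T s := by
  have mono : ∀ {T T' s}, S.ReturnsBy ℓ h v T s → T ≤ T' → S.ReturnsBy ℓ h v T' s :=
    fun ⟨t, ht, H⟩ hle => ⟨t, ⟨ht.1, ht.2.trans hle⟩, H⟩
  suffices ∃ T, ∀ s ∈ Icc 0 ℓ, s ∈ Ioo 0 ℓ → (∃ t > 0, ∃ s' ∈ Ioo 0 ℓ, S.Flow v t (h s) (h s')) →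
      S.ReturnsBy ℓ h v T s by
    obtain ⟨T, H⟩ := this
    exact ⟨T, fun s hs => H s (Ioo_subset_Icc_self hs) hs⟩
  refine isCompact_Icc.induction_on (p := fun W => ∃ T, ∀ s ∈ W, s ∈ Ioo 0 ℓ →
    (∃ t > 0, ∃ s' ∈ Ioo 0 ℓ, S.Flow v t (h s) (h s')) → S.ReturnsBy ℓ h v T s)
    ⟨0, by simp⟩ ?_ ?_ ?_
  · rintro W W' hW ⟨T, H⟩
    exact ⟨T, fun s hs => H s (hW hs)⟩
  · rintro W W' ⟨T, H⟩ ⟨T', H'⟩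
    refine ⟨max T T', ?_⟩
    rintro s (hs | hs) h1 h2
    · exact mono (H s hs h1 h2) (le_max_left _ _)
    · exact mono (H' s hs h1 h2) (le_max_right _ _)
  -- Break points are isolated, so near `x` there are two break-free intervals. Only `x` itself may
  -- fail to return, and the assumption of a return is needed only there. Working on `Icc 0 ℓ`
  -- covers the approach to the endpoints.
  intro x hx
  have hfin : ((S.breaks ℓ h v) \ {x}).Finite := (finite_breaks hw.horizontal hw.injOn v).sdiff
  obtain ⟨ε, hε, hball⟩ := Metric.mem_nhds_iff.1
    (hfin.isClosed.isOpen_compl.mem_nhds (x := x) (by simp))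
  have hnb : ∀ s, |s - x| < ε → s ≠ x → s ∉ S.breaks ℓ h v := fun s hs hsx hsb =>
    hball (by simpa [Real.dist_eq] using hs : s ∈ Metric.ball x ε) ⟨hsb, hsx⟩
  obtain ⟨T₁, hT₁⟩ := hw.exists_returnsBy hv (a := max 0 (x - ε)) (b := x)
    (fun s hs => ⟨(le_max_left _ _).trans_lt hs.1, hs.2.trans_le hx.2⟩)
    (fun s hs => hnb s (by
      have := (le_max_right _ _).trans_lt hs.1
      rw [abs_lt]; constructor <;> linarith [hs.2]) hs.2.ne)
  obtain ⟨T₂, hT₂⟩ := hw.exists_returnsBy hv (a := x) (b := min ℓ (x + ε))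
    (fun s hs => ⟨hx.1.trans_lt hs.1, hs.2.trans_le (min_le_left _ _)⟩)
    (fun s hs => hnb s (by
      have := hs.2.trans_le (min_le_right _ _)
      rw [abs_lt]; constructor <;> linarith [hs.1]) hs.1.ne')
  obtain ⟨T₃, hT₃⟩ : ∃ T, (∃ t > 0, ∃ s' ∈ Ioo 0 ℓ, S.Flow v t (h x) (h s')) →
      S.ReturnsBy ℓ h v T x := by
    by_cases H : ∃ t > 0, ∃ s' ∈ Ioo 0 ℓ, S.Flow v t (h x) (h s')
    · obtain ⟨t, ht, H⟩ := H
      exact ⟨t, fun _ => ⟨t, ⟨ht, le_rfl⟩, H⟩⟩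
    · exact ⟨0, fun h => absurd h H⟩
  refine ⟨Metric.ball x ε, mem_nhdsWithin_of_mem_nhds (Metric.ball_mem_nhds x hε),
    max T₁ (max T₂ T₃), fun s hs hsℓ hret => ?_⟩
  have hs' := abs_lt.1 (Metric.mem_ball.1 hs)
  rcases lt_trichotomy s x with hlt | rfl | hlt
  · exact mono (hT₁ s ⟨max_lt hsℓ.1 (by linarith [hs'.1]), hlt⟩) (le_max_left _ _)
  · exact mono (hT₃ hret) ((le_max_right _ _).trans (le_max_right _ _))
  · exact mono (hT₂ s ⟨hlt, lt_min hsℓ.2 (by linarith [hs'.2])⟩)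
      ((le_max_left _ _).trans (le_max_right _ _))

end

/-! ### Grades and times to fall -/

section

variable {X : Type*} [TopologicalSpace X] {S : TranslationSurface X} [T2Space X]

/-- A trajectory which meets the segment again does so for a first time, and not too early. -/
theorem exists_firstReturn {h : ℝ → X} {ℓ : ℝ} (hh : S.IsStraight 1 h (Icc 0 ℓ)) {v : ℂ}
    (hv : v.im ≠ 0) : ∃ δ > 0, ∀ s ∈ Ioo 0 ℓ,
      (∃ t > 0, ∃ s' ∈ Ioo 0 ℓ, S.Flow v t (h s) (h s')) →
      ∃ u ∈ Ioo 0 ℓ, S.FirstReturn ℓ h v s u ∧ ∃ t ≥ δ, S.Flow v t (h s) (h u) := by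
  obtain ⟨δ, hδ, hmin⟩ := exists_min_return isCompact_Icc hh hv
  refine ⟨δ, hδ, fun s hs hret => ?_⟩
  set A : Set ℝ := {t | 0 < t ∧ ∃ s' ∈ Ioo 0 ℓ, S.Flow v t (h s) (h s')} with hA
  have hne : ((fun t : ℝ => ⌊t / δ⌋₊) '' A).Nonempty := by
    obtain ⟨t, ht, H⟩ := hret
    exact ⟨_, t, ⟨ht, H⟩, rfl⟩
  -- Minimizing `⌊t / δ⌋` is enough, because an earlier return would precede by at least `δ` and
  -- lower the floor.
  obtain ⟨_, ⟨t, ⟨ht, u, hu, hfl⟩, rfl⟩, hleast⟩ := WellFounded.has_min Nat.lt_wfRel.wf _ hne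
  refine ⟨u, hu, ⟨hs, hu, t, ht, hfl, ?_⟩, t, ?_, hfl⟩
  · rintro r hr q hq ⟨s', hs', rfl⟩
    have h1 : S.Flow v (t - r) (h s') (h u) := by
      simpa [sub_eq_neg_add] using hq.symm.trans hfl
    have h2 : δ ≤ t - r := by
      by_contra! hlt
      exact hmin s' (Ioo_subset_Icc_self hs') u (Ioo_subset_Icc_self hu) _
        ⟨sub_pos.2 hr.2, hlt⟩ h1
    refine hleast _ (mem_image_of_mem _ ⟨hr.1, s', hs', hq⟩) ?_
    have h3 : r / δ + 1 ≤ t / δ := by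
      rw [← le_sub_iff_add_le', ← sub_div, one_le_div hδ]
      exact h2
    have h4 := Nat.floor_le_floor h3
    rw [Nat.floor_add_one (div_nonneg hr.1.le hδ.le)] at h4
    exact h4
  · by_contra! hlt
    exact hmin s (Ioo_subset_Icc_self hs) u (Ioo_subset_Icc_self hu) t ⟨ht, hlt⟩ hfl

/-- A trajectory that falls into a singularity passes a break point before. -/
theorem exists_iterReturn {h : ℝ → X} {ℓ : ℝ} (hh : S.IsStraight 1 h (Icc 0 ℓ)) {v : ℂ}
    (hv : v.im ≠ 0) {s : ℝ} (hs : s ∈ Ioo 0 ℓ) (hc : h s ∈ S.critical v) :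
    ∃ n, ∃ b ∈ S.breaks ℓ h v, S.IterReturn ℓ h v n s b := by
  obtain ⟨δ, hδ, hfirst⟩ := exists_firstReturn hh hv
  -- Each return uses up at least `δ` of the time left before the fall, so the induction is on the
  -- number of such units.
  have key : ∀ n : ℕ, ∀ s ∈ Ioo 0 ℓ, ∀ T ≤ n * δ, S.Falls v T (h s) →
      ∃ n, ∃ b ∈ S.breaks ℓ h v, S.IterReturn ℓ h v n s b := by
    intro n
    induction n with
    | zero =>
      rintro s - T hT ⟨b, hb⟩
      have := hb.1
      simp at hT
      linarith
    | succ n ih =>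
      intro s hs T hT hf
      by_cases hret : ∃ t > 0, ∃ s' ∈ Ioo 0 ℓ, S.Flow v t (h s) (h s')
      · obtain ⟨u, hu, hsu, t, ht, hfl⟩ := hfirst s hs hret
        obtain ⟨k, b, hb, hk⟩ := ih u hu (T - t)
          (by push_cast at hT; linarith) (hf.of_flow hfl)
        exact ⟨k + 1, b, hb, u, hsu, hk⟩
      · refine ⟨0, s, ⟨hs, mem_critical_iff.2 ⟨T, hf⟩, ?_⟩, rfl⟩
        rintro t ht q hq ⟨s', hs', rfl⟩
        exact hret ⟨t, ht, s', hs', hq⟩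
  obtain ⟨T, hT⟩ := mem_critical_iff.1 hc
  obtain ⟨n, hn⟩ := exists_nat_ge (T / δ)
  exact key n s hs T ((div_le_iff₀ hδ).1 hn) hT

/-- One constant bounds both the first return times and the falling times from break points; the
extra `1` accounts for the final fall. -/
theorem IsWellCut.exists_bound_iterReturn [CompactSpace X] {ℓ : ℝ} {h : ℝ → X}
    (hw : S.IsWellCut ℓ h) {v : ℂ} (hv : v = Complex.I ∨ v = -Complex.I) :
    ∃ C : ℝ, ∀ n : ℕ, ∀ s, ∀ b ∈ S.breaks ℓ h v, S.IterReturn ℓ h v n s b →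
      ∃ t ≤ C * (n + 1), S.Falls v t (h s) := by
  obtain ⟨T, hT⟩ := hw.exists_bound_return hv
  obtain ⟨D, hD⟩ := exists_bound_falls_breaks hw.horizontal hw.injOn v
  refine ⟨max T D, fun n => ?_⟩
  have h1 := le_max_left T D
  have h2 := le_max_right T D
  induction n with
  | zero =>
    rintro s b hb rfl
    obtain ⟨t, ht⟩ := mem_critical_iff.1 hb.2.1
    exact ⟨t, by simpa using (hD s hb t ht).trans h2, ht⟩
  | succ n ih =>
    rintro s b hb ⟨u, ⟨hs, hu, t, ht, hfl, hfirst⟩, hub⟩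
    obtain ⟨t', ht', hf⟩ := ih u b hb hub
    obtain ⟨r, hr, s', hs', hr'⟩ := hT s hs ⟨t, ht, u, hu, hfl⟩
    have h3 : t ≤ T := by
      by_contra! hlt
      exact hfirst r ⟨hr.1, hr.2.trans_lt hlt⟩ _ hr' (mem_image_of_mem h hs')
    refine ⟨t + t', ?_, hfl.falls hf ht.le⟩
    push_cast
    linarith

/-- The time to fall into a singularity grows at most linearly with the grade. -/
theorem IsWellCut.exists_bound_falls [CompactSpace X] {ℓ : ℝ} {h : ℝ → X}
    (hw : S.IsWellCut ℓ h) : ∃ C : ℝ, 0 < C ∧ ∀ s ∈ S.positions ℓ h, ∀ n, S.grade ℓ h s ≤ n →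
      ∃ v, (v = Complex.I ∨ v = -Complex.I) ∧ ∃ t ≤ C * (n + 1), S.Falls v t (h s) := by
  obtain ⟨C₁, hC₁⟩ := hw.exists_bound_iterReturn (Or.inl rfl)
  obtain ⟨C₂, hC₂⟩ := hw.exists_bound_iterReturn (Or.inr rfl)
  have hle : ∀ {k n : ℕ} {C D : ℝ}, C ≤ D → 0 < D → k ≤ n → C * (k + 1) ≤ D * (n + 1) := by
    intro k n C D h1 h2 h3
    have : (k : ℝ) ≤ n := by exact_mod_cast h3
    have h0 : (0 : ℝ) ≤ k := k.cast_nonneg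
    nlinarith
  have hpos : 0 < max 1 (max C₁ C₂) := lt_max_of_lt_left one_pos
  refine ⟨max 1 (max C₁ C₂), hpos, fun s hs n hn => ?_⟩
  have hmem : S.grade ℓ h s ∈ {n | (∃ b ∈ S.breaks ℓ h Complex.I,
      S.IterReturn ℓ h Complex.I n s b) ∨
      (∃ b ∈ S.breaks ℓ h (-Complex.I), S.IterReturn ℓ h (-Complex.I) n s b)} := by
    -- Every position does reach a break point, so the grade is attained and is not the default
    -- value `0` of `sInf ∅`.
    refine Nat.sInf_mem ?_
    rcases hs.2 with hc | hc
    · obtain ⟨k, hk⟩ := exists_iterReturn hw.horizontal (by simp) hs.1 hc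
      exact ⟨k, Or.inl hk⟩
    · obtain ⟨k, hk⟩ := exists_iterReturn hw.horizontal (by simp) hs.1 hc
      exact ⟨k, Or.inr hk⟩
  rcases hmem with ⟨b, hb, hk⟩ | ⟨b, hb, hk⟩
  · obtain ⟨t, ht, hf⟩ := hC₁ _ s b hb hk
    exact ⟨_, Or.inl rfl, t, ht.trans (hle ((le_max_left _ _).trans (le_max_right _ _)) hpos hn),
      hf⟩
  · obtain ⟨t, ht, hf⟩ := hC₂ _ s b hb hk
    exact ⟨_, Or.inr rfl, t, ht.trans (hle ((le_max_right _ _).trans (le_max_right _ _)) hpos hn),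
      hf⟩

end

/-! ### Generalized saddle connections and gaps -/

section

variable {X : Type*} [TopologicalSpace X] {S : TranslationSurface X}

theorem neg_mem_dom_neg {v : ℂ} {p : X} {t : ℝ} : -t ∈ S.dom (-v) p ↔ t ∈ S.dom v p :=
  exists_congr fun _ => flow_neg_iff

/-- The velocity can be read off in a chart at the midpoint. Since `IsDiophantine` counts curves,
this is what makes the exceptional holonomies finite in number as well. -/
theorem IsGeneralizedSaddleConnection.holonomy_unique {γ : C(unitInterval, X)} {Q Q' : ℂ}
    (h : S.IsGeneralizedSaddleConnection γ Q) (h' : S.IsGeneralizedSaddleConnection γ Q') :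
    Q = Q' := by
  have hm : (1 / 2 : ℝ) ∈ Ioo (0 : ℝ) 1 := by norm_num
  obtain ⟨h1, h2⟩ := h.2.2.2 _ hm
  obtain ⟨z, hz, hzs⟩ := S.charts_cover _ h1
  have h3 := (h2 z hz hzs).and ((h'.2.2.2 _ hm).2 z hz hzs)
  rw [nhdsWithin_eq_nhds.2 (Ioo_mem_nhds hm.1 hm.2)] at h3
  obtain ⟨r, ⟨hr, hr'⟩, hne⟩ := ((h3.filter_mono nhdsWithin_le_nhds).and
    (self_mem_nhdsWithin (a := (1 / 2 : ℝ)) (s := {1 / 2}ᶜ))).exists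
  refine mul_left_cancel₀ ?_ (hr.2.symm.trans hr'.2)
  exact_mod_cast sub_ne_zero.2 hne

theorem exists_pos_le_re {Γ : Set C(unitInterval, X)} (hΓ : Γ.Finite) :
    ∃ c > 0, ∀ γ ∈ Γ, ∀ Q : ℂ, S.IsGeneralizedSaddleConnection γ Q → 0 < Q.re → c ≤ Q.re := by
  have : ∀ γ ∈ Γ, ∀ᶠ c : ℝ in 𝓝[>] 0, ∀ Q : ℂ, S.IsGeneralizedSaddleConnection γ Q →
      0 < Q.re → c ≤ Q.re := by
    intro γ _
    by_cases H : ∃ Q : ℂ, S.IsGeneralizedSaddleConnection γ Q ∧ 0 < Q.re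
    · obtain ⟨Q, hQ, hpos⟩ := H
      filter_upwards [mem_nhdsWithin_of_mem_nhds (Iio_mem_nhds hpos)] with c hc Q' hQ' _
      rw [hQ'.holonomy_unique hQ]
      exact le_of_lt hc
    · exact Eventually.of_forall fun c Q hQ hpos => absurd ⟨Q, hQ, hpos⟩ H
  obtain ⟨c, hc, hpos⟩ := (((eventually_all_finite hΓ).2 this).and self_mem_nhdsWithin).exists
  exact ⟨c, hpos, hc⟩

variable [T2Space X]

theorem fl_neg (v : ℂ) (p : X) (t : ℝ) : S.fl (-v) p (-t) = S.fl v p t := by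
  by_cases ht : t ∈ S.dom v p
  · exact (flow_fl ht).neg.fl_eq
  -- Outside the domain both sides take the default value `p`.
  · have ht' : ¬ ∃ q, S.Flow (-v) (-t) p q := fun h => ht (neg_mem_dom_neg.1 h)
    have ht'' : ¬ ∃ q, S.Flow v t p q := ht
    rw [fl, fl, dif_neg ht', dif_neg ht'']

/-- Trajectories that start next to a trajectory falling into `b` pass close to `b`. -/
theorem FallsTo.tendsto_strip {h : ℝ → X} {J : Set ℝ} (hh : S.IsStraight 1 h J) {v : ℂ} {s t : ℝ}
    {b : X} (hf : S.FallsTo v t (h s) b) {N Y : Set ℝ} (hN : N ⊆ J) (hs : s ∈ J)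
    (hY : Y.OrdConnected) (h0 : Icc 0 t ⊆ Y) (hdom : ∀ r ∈ N, Y ⊆ S.dom v (h r)) :
    Tendsto (fun u : ℝ × ℝ => S.fl v (h u.1) u.2) (𝓝[N ×ˢ Y] (s, t)) (𝓝 b) := by
  obtain ⟨m, ζ, hζ⟩ := S.exists_isCoord b
  refine hζ.tendsto_of_norm fun ρ hρ => ?_
  obtain ⟨R, hR, hRρ, hball⟩ := hζ.exists_closedBall hρ
  obtain ⟨η, hη, hη0, hηt⟩ : ∃ η : ℝ, η * ‖v‖ < R ^ m / 2 ∧ 0 < η ∧ η < t := by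
    have h1 : ∀ᶠ η : ℝ in 𝓝[>] 0, η * ‖v‖ < R ^ m / 2 := by
      have : Continuous (fun η : ℝ => η * ‖v‖) := by fun_prop
      refine mem_nhdsWithin_of_mem_nhds (this.continuousAt.eventually (gt_mem_nhds ?_))
      simp only [zero_mul]
      positivity
    obtain ⟨η, h2, h3⟩ := (h1.and (Ioo_mem_nhdsGT hf.1)).exists
    exact ⟨η, h2, h3⟩
  have hmem : t - η ∈ Ico 0 t := ⟨by linarith, by linarith⟩
  have h1 := hf.coord hζ hR hball hmem (by
    rw [sub_sub_cancel]; exact hη.trans (half_lt_self (by positivity)))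
  have e1 : ‖ζ (S.fl v (h s) (t - η))‖ ^ m < R ^ m / 2 := by
    rw [← norm_pow, h1.2.2, norm_mul, Complex.norm_real, Real.norm_eq_abs, sub_sub_cancel_left,
      abs_neg, abs_of_pos hη0]
    exact hη
  have hsl : Tendsto (fun r => S.fl v (h r) (t - η)) (𝓝[N] s) (𝓝 (S.fl v (h s) (t - η))) := by
    -- The side `s` need not belong to `N`, but up to height `t - η` its trajectory is still
    -- defined, so it can be added.
    have h2 := (locDev_strip hh (N := insert s N) (Y := Icc 0 (t - η))
      (insert_subset hs hN) ordConnected_Icc (left_mem_Icc.2 hmem.1) (v := v) ?_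
      (mem_insert s N) (right_mem_Icc.2 hmem.1)).tendsto (tendsto_strip_displacement _ _ _ _)
    · refine h2.comp (f := fun r => (r, t - η)) ?_
      rw [nhdsWithin_prod_eq]
      exact (tendsto_id.mono_left (nhdsWithin_mono s (subset_insert s N))).prodMk
        (tendsto_const_nhdsWithin (right_mem_Icc.2 hmem.1))
    · rintro r (rfl | hr)
      · exact (Icc_subset_Ico_right hmem.2).trans hf.2.2.1
      · exact ((Icc_subset_Icc_right hmem.2.le).trans h0).trans (hdom r hr)
  have hev : ∀ᶠ q in 𝓝 (S.fl v (h s) (t - η)), q ∈ ζ.source ∧ ‖ζ q‖ ^ m < R ^ m / 2 := by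
    filter_upwards [ζ.open_source.mem_nhds h1.1,
      ((ζ.continuousAt h1.1).norm.pow m).eventually (gt_mem_nhds e1)] with q h2 h3
    exact ⟨h2, h3⟩
  have hev2 : ∀ᶠ y in 𝓝[Y] t, |y - (t - η)| * ‖v‖ < R ^ m / 2 := by
    have : Continuous (fun y : ℝ => |y - (t - η)| * ‖v‖) := by fun_prop
    refine mem_nhdsWithin_of_mem_nhds (this.continuousAt.eventually (gt_mem_nhds ?_))
    simp only [sub_sub_cancel, abs_of_pos hη0]
    exact hη
  filter_upwards [tendsto_fst_nhdsWithin_prod.eventually (hsl.eventually hev),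
    tendsto_snd_nhdsWithin_prod.eventually hev2, self_mem_nhdsWithin] with u hu1 hu2 hu
  have h3 := ((isStraight_fl v (h u.1)).mono (hdom u.1 hu.1)).stay hY hζ hR hball
    (h0 ⟨hmem.1, hmem.2.le⟩) hu.2 hu1.1 (by linarith [hu1.2])
  exact ⟨h3.1, h3.2.1.trans hRρ⟩

/-- Backward falls are reflected in time, so that singularities above and below the segment become
boundary points, at heights in `[-T, T]`, of one strip for the upward flow. -/
theorem FallsTo.exists_tendsto_strip {h : ℝ → X} {J : Set ℝ} (hh : S.IsStraight 1 h J) {v : ℂ}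
    (hv : v = Complex.I ∨ v = -Complex.I) {s t T : ℝ} (htT : t ≤ T)
    {b : X} (hf : S.FallsTo v t (h s) b) {N : Set ℝ} (hN : N ⊆ J) (hs : s ∈ J)
    (hdom : ∀ r ∈ N, Icc (-T) T ⊆ S.dom Complex.I (h r)) :
    ∃ τ ∈ Icc (-T) T, Tendsto (fun u : ℝ × ℝ => S.fl Complex.I (h u.1) u.2)
      (𝓝[N ×ˢ Icc (-T) T] (s, τ)) (𝓝 b) := by
  have ht := hf.1
  have hsub : Icc 0 t ⊆ Icc (-T) T := Icc_subset_Icc (by linarith) htT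
  rcases hv with rfl | rfl
  · exact ⟨t, hsub (right_mem_Icc.2 ht.le),
      hf.tendsto_strip hh hN hs ordConnected_Icc hsub hdom⟩
  · refine ⟨-t, ⟨by linarith, by linarith⟩, ?_⟩
    have h1 := hf.tendsto_strip hh hN hs ordConnected_Icc hsub (fun r hr y hy => by
      rw [← neg_neg y, neg_mem_dom_neg]
      exact hdom r hr ⟨by linarith [hy.2], by linarith [hy.1]⟩)
    have h2 : Tendsto (fun u : ℝ × ℝ => (u.1, -u.2)) (𝓝[N ×ˢ Icc (-T) T] (s, -t))
        (𝓝[N ×ˢ Icc (-T) T] (s, t)) := by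
      refine tendsto_nhdsWithin_iff.2 ⟨?_, ?_⟩
      · have : Continuous (fun u : ℝ × ℝ => (u.1, -u.2)) := by fun_prop
        simpa using (this.tendsto (s, -t)).mono_left nhdsWithin_le_nhds
      · filter_upwards [self_mem_nhdsWithin] with u hu
        exact ⟨hu.1, by linarith [hu.2.2], by linarith [hu.2.1]⟩
    refine (h1.comp h2).congr fun u => ?_
    simp only [Function.comp, fl_neg]

variable [CompactSpace X]

/-- A strip over a horizontal interval whose sides fall into singularities, but whose interior
does not, is crossed by a generalized saddle connection. -/
theorem exists_saddle_of_strip {h : ℝ → X} {J : Set ℝ} (hh : S.IsStraight 1 h J)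
    {s₁ s₂ t₁ t₂ T : ℝ} (hs : s₁ < s₂) (hJ : Icc s₁ s₂ ⊆ J) {v₁ v₂ : ℂ}
    (hv₁ : v₁ = Complex.I ∨ v₁ = -Complex.I) (hv₂ : v₂ = Complex.I ∨ v₂ = -Complex.I)
    (hf₁ : S.Falls v₁ t₁ (h s₁)) (ht₁ : t₁ ≤ T) (hf₂ : S.Falls v₂ t₂ (h s₂)) (ht₂ : t₂ ≤ T)
    (hdom : ∀ r ∈ Ioo s₁ s₂, Icc (-T) T ⊆ S.dom Complex.I (h r)) :
    ∃ γ Q, S.IsGeneralizedSaddleConnection γ Q ∧ Q.re = s₂ - s₁ ∧ |Q.im| ≤ 2 * T := by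
  obtain ⟨b₁, hb₁⟩ := hf₁
  obtain ⟨b₂, hb₂⟩ := hf₂
  have hN : Ioo s₁ s₂ ⊆ J := Ioo_subset_Icc_self.trans hJ
  obtain ⟨τ₁, hτ₁, hlim₁⟩ := hb₁.exists_tendsto_strip hh hv₁ ht₁ hN
    (hJ (left_mem_Icc.2 hs.le)) hdom
  obtain ⟨τ₂, hτ₂, hlim₂⟩ := hb₂.exists_tendsto_strip hh hv₂ ht₂ hN
    (hJ (right_mem_Icc.2 hs.le)) hdom
  have hT : 0 ≤ T := hb₁.1.le.trans ht₁
  set g : ℝ → X := fun t => S.fl Complex.I (h (s₁ + t * (s₂ - s₁))) (τ₁ + t * (τ₂ - τ₁)) with hg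
  set Q : ℂ := ((s₂ - s₁ : ℝ) : ℂ) + ((τ₂ - τ₁ : ℝ) : ℂ) * Complex.I with hQ
  have hmem : ∀ t ∈ Ioo (0 : ℝ) 1, s₁ + t * (s₂ - s₁) ∈ Ioo s₁ s₂ ∧
      τ₁ + t * (τ₂ - τ₁) ∈ Icc (-T) T := by
    intro t ht
    have h1 : 0 < s₂ - s₁ := sub_pos.2 hs
    refine ⟨⟨by nlinarith [ht.1], by nlinarith [ht.2]⟩, ?_⟩
    have := (convex_Icc (-T) T).add_smul_sub_mem hτ₁ hτ₂ (Ioo_subset_Icc_self ht)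
    simpa using this
  have hstr : S.IsStraight Q g (Ioo 0 1) :=
    isStraight_strip hh hN ordConnected_Icc ⟨by linarith, hT⟩ hdom s₁ τ₁ _ _ hmem
  have hk : Continuous (fun t : ℝ => (s₁ + t * (s₂ - s₁), τ₁ + t * (τ₂ - τ₁))) := by fun_prop
  have hl : Tendsto g (𝓝[>] 0) (𝓝 b₁) := by
    refine hlim₁.comp (f := fun t : ℝ => (s₁ + t * (s₂ - s₁), τ₁ + t * (τ₂ - τ₁)))
      (tendsto_nhdsWithin_iff.2 ⟨?_, ?_⟩)
    · simpa using (hk.tendsto 0).mono_left nhdsWithin_le_nhds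
    · filter_upwards [Ioo_mem_nhdsGT one_pos] with t ht
      exact hmem t ht
  have hr : Tendsto g (𝓝[<] 1) (𝓝 b₂) := by
    refine hlim₂.comp (f := fun t : ℝ => (s₁ + t * (s₂ - s₁), τ₁ + t * (τ₂ - τ₁)))
      (tendsto_nhdsWithin_iff.2 ⟨?_, ?_⟩)
    · simpa using (hk.tendsto 1).mono_left nhdsWithin_le_nhds
    · filter_upwards [Ioo_mem_nhdsLT one_pos] with t ht
      exact hmem t ht
  have hcont := continuousOn_Icc_extendFrom_Ioo hstr.continuousOn hl hr
  refine ⟨⟨fun t => extendFrom (Ioo 0 1) g t, continuousOn_iff_continuous_domRestrict.1 hcont⟩,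
    Q, ⟨?_, ?_, ?_, ?_⟩, ?_, ?_⟩
  · intro h0
    have := congrArg Complex.re h0
    simp [hQ] at this
    linarith
  · have := eq_lim_at_left_extendFrom_Ioo one_pos hl
    change extendFrom (Ioo 0 1) g (0 : ℝ) ∈ S.sing
    rw [this]
    exact hb₁.2.1
  · have := eq_lim_at_right_extendFrom_Ioo one_pos hr
    change extendFrom (Ioo 0 1) g (1 : ℝ) ∈ S.sing
    rw [this]
    exact hb₂.2.1
  · refine hstr.congr fun t ht => ?_
    rw [IccExtend_of_mem _ _ (Ioo_subset_Icc_self ht)]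
    exact (extendFrom_extends hstr.continuousOn t ht).symm
  · simp [hQ]
  · have : Q.im = τ₂ - τ₁ := by simp [hQ]
    rw [this, abs_le]
    constructor <;> linarith [hτ₁.1, hτ₁.2, hτ₂.1, hτ₂.2]

/-- Two points of a horizontal segment that fall into singularities soon give rise to a short
generalized saddle connection that is nearly vertical if they are close to each other. -/
theorem exists_saddle {h : ℝ → X} {ℓ : ℝ} (hh : S.IsStraight 1 h (Icc 0 ℓ))
    (hinj : InjOn h (Ioo 0 ℓ)) {w₁ w₂ T : ℝ} (hw₁ : w₁ ∈ Ioo 0 ℓ) (hw₂ : w₂ ∈ Ioo 0 ℓ)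
    (hw : w₁ < w₂)
    (hf₁ : ∃ v, (v = Complex.I ∨ v = -Complex.I) ∧ ∃ t ≤ T, S.Falls v t (h w₁))
    (hf₂ : ∃ v, (v = Complex.I ∨ v = -Complex.I) ∧ ∃ t ≤ T, S.Falls v t (h w₂)) :
    ∃ γ Q, S.IsGeneralizedSaddleConnection γ Q ∧ 0 < Q.re ∧ Q.re ≤ w₂ - w₁ ∧
      |Q.im| ≤ 2 * T := by
  set A : Set ℝ := {s ∈ Ioo 0 ℓ | ∃ v, (v = Complex.I ∨ v = -Complex.I) ∧
    ∃ t ≤ T, S.Falls v t (h s)} with hA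
  have hfin : A.Finite := by
    refine ((finite_falls hh hinj (v := Complex.I) (by simp) T).union
      (finite_falls hh hinj (v := -Complex.I) (by simp) T)).subset ?_
    rintro s ⟨hs, v, rfl | rfl, H⟩
    · exact Or.inl ⟨hs, H⟩
    · exact Or.inr ⟨hs, H⟩
  -- The nearest point to the right of `w₁` that falls within time `T`; the strip over the interval
  -- between them is then free of singularities.
  obtain ⟨s₂, ⟨⟨hs₂, v₂, hv₂, t₂, ht₂, hf₂'⟩, hlt⟩, hmin⟩ :=
    (hfin.inter_of_left (Ioi w₁)).exists_minimal ⟨w₂, ⟨hw₂, hf₂⟩, hw⟩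
  rw [mem_Ioi] at hlt
  have hle : s₂ ≤ w₂ := by
    rcases le_total s₂ w₂ with h1 | h1
    · exact h1
    · exact hmin ⟨⟨hw₂, hf₂⟩, hw⟩ h1
  obtain ⟨v₁, hv₁, t₁, ht₁, hf₁'⟩ := hf₁
  have hJ : Icc w₁ s₂ ⊆ Icc 0 ℓ := Icc_subset_Icc hw₁.1.le hs₂.2.le
  have hdom : ∀ r ∈ Ioo w₁ s₂, Icc (-T) T ⊆ S.dom Complex.I (h r) := by
    intro r hr y hy
    have hrI : r ∈ Ioo 0 ℓ := ⟨hw₁.1.trans hr.1, hr.2.trans hs₂.2⟩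
    have hrA : r ∉ A := fun hrA => absurd (hmin ⟨hrA, hr.1⟩ hr.2.le) (not_le.2 hr.2)
    have hreg := (hh r (Ioo_subset_Icc_self hrI)).1
    rcases le_total 0 y with h0 | h0
    · refine (mem_dom_or_falls hreg h0).resolve_right ?_
      rintro ⟨T', hT', hf⟩
      exact hrA ⟨hrI, _, Or.inl rfl, T', hT'.trans hy.2, hf⟩
    · rw [← neg_mem_dom_neg]
      refine (mem_dom_or_falls hreg (neg_nonneg.2 h0)).resolve_right ?_
      rintro ⟨T', hT', hf⟩
      exact hrA ⟨hrI, _, Or.inr rfl, T', by linarith [hy.1], hf⟩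
  obtain ⟨γ, Q, hγ, hre, him⟩ :=
    exists_saddle_of_strip hh hlt hJ hv₁ hv₂ hf₁' ht₁ hf₂' ht₂ hdom
  exact ⟨γ, Q, hγ, by linarith, by linarith, him⟩

theorem IsWellCut.segmentFatGap {ℓ : ℝ} {h : ℝ → X} (hw : S.IsWellCut ℓ h) {K : ℝ} (hK : 1 < K)
    (hdio : ∀ ε : ℝ, 0 < ε → S.IsDiophantine (fun t => K ^ (-(ε * t)))) :
    S.SegmentFatGap ℓ h K := by
  intro ε hε
  have hK0 : 0 < K := one_pos.trans hK
  obtain ⟨C, hC, hfalls⟩ := hw.exists_bound_falls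
  -- Since `‖Q‖ ≤ ℓ + 2 C (n + 1)`, the exponent `ε / (2 C)` costs exactly `ε n` plus a constant.
  -- That constant goes into `c₁`, while `c₀` handles the exceptional curves.
  obtain ⟨c₀, hc₀, hexc⟩ := exists_pos_le_re (S := S) (hdio (ε / (2 * C)) (by positivity))
  set c₁ : ℝ := K ^ (-(ε / (2 * C) * (ℓ + 2 * C))) with hc₁
  have hc₁pos : 0 < c₁ := Real.rpow_pos_of_pos hK0 _
  refine ⟨min c₀ c₁, lt_min hc₀ hc₁pos, fun n => ?_⟩
  have hP : 0 < K ^ (ε * n) := Real.rpow_pos_of_pos hK0 _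
  have hP1 : 1 ≤ K ^ (ε * n) := Real.one_le_rpow hK.le (by positivity)
  set A : Set ℝ := {s ∈ S.positions ℓ h | K ^ (-(n : ℝ)) ≤ S.height ℓ h K s} with hA
  have hAf : ∀ s ∈ A, s ∈ Ioo 0 ℓ ∧ ∃ v, (v = Complex.I ∨ v = -Complex.I) ∧
      ∃ t ≤ C * (n + 1), S.Falls v t (h s) := by
    rintro s ⟨hs, hsn⟩
    refine ⟨hs.1, hfalls s hs n ?_⟩
    rw [height, Real.rpow_le_rpow_left_iff hK, neg_le_neg_iff] at hsn
    exact_mod_cast hsn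
  have key : ∀ s ∈ A, ∀ s' ∈ A, s < s' → min c₀ c₁ ≤ K ^ (ε * n) * (s' - s) := by
    intro s hs s' hs' hlt
    obtain ⟨h1, h2⟩ := hAf s hs
    obtain ⟨h1', h2'⟩ := hAf s' hs'
    obtain ⟨γ, Q, hγ, hQ0, hQ1, hQ2⟩ := exists_saddle hw.horizontal hw.injOn h1 h1' hlt h2 h2'
    have hQle : K ^ (ε * n) * Q.re ≤ K ^ (ε * n) * (s' - s) := by gcongr
    refine le_trans ?_ hQle
    by_cases hex : |Q.re| < K ^ (-(ε / (2 * C) * ‖Q‖))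
    · refine (min_le_left _ _).trans ((hexc γ ⟨Q, hγ, hex⟩ Q hγ hQ0).trans ?_)
      exact le_mul_of_one_le_left hQ0.le hP1
    · rw [not_lt, abs_of_pos hQ0] at hex
      refine (min_le_right _ _).trans ?_
      have hnorm : ‖Q‖ ≤ ℓ + 2 * C * (n + 1) := by
        have := Complex.norm_le_abs_re_add_abs_im Q
        rw [abs_of_pos hQ0] at this
        linarith [h1.1, h1'.2]
      have hpow : c₁ = K ^ (ε * n) * K ^ (-(ε / (2 * C) * (ℓ + 2 * C * (n + 1)))) := by
        rw [hc₁, ← Real.rpow_add hK0]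
        congr 1
        field_simp
        ring
      rw [hpow]
      refine mul_le_mul_of_nonneg_left (le_trans ?_ hex) hP.le
      refine Real.rpow_le_rpow_of_exponent_le hK.le ?_
      have : 0 < ε / (2 * C) := by positivity
      gcongr
  have hsep : ENNReal.ofReal (min c₀ c₁ / K ^ (ε * n)) ≤ A.einfsep := by
    refine le_einfsep_iff.2 fun s hs s' hs' hne => ?_
    rw [edist_dist]
    refine ENNReal.ofReal_le_ofReal ((div_le_iff₀' hP).2 ?_)
    rcases lt_or_gt_of_ne hne with hlt | hlt
    · rw [dist_comm, Real.dist_eq, abs_of_pos (sub_pos.2 hlt)]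
      exact key s hs s' hs' hlt
    · rw [Real.dist_eq, abs_of_pos (sub_pos.2 hlt)]
      exact key s' hs' s hs hlt
  calc ENNReal.ofReal (min c₀ c₁)
      = ENNReal.ofReal (K ^ (ε * n)) * ENNReal.ofReal (min c₀ c₁ / K ^ (ε * n)) := by
        rw [← ENNReal.ofReal_mul hP.le, mul_div_cancel₀ _ hP.ne']
    _ ≤ _ := by
        rw [gap]
        gcongr

end

end TranslationSurface

theorem mainTheorem6 {X : Type*} [TopologicalSpace X] [T2Space X] [CompactSpace X]
    [MeasurableSpace X] [BorelSpace X] (S : TranslationSurface X) (K : ℝ) (hK : 1 < K)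
    (hsaddle : S.NoSaddleConnections) (herg : S.VerticalFlowUniquelyErgodic)
    (hdio : ∀ ε : ℝ, 0 < ε → S.IsDiophantine (fun t => K ^ (-(ε * t)))) :
    S.FatGap K := by
  exact fun _ _ hw => hw.segmentFatGap hK hdio
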